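/- Let $X$ be a connected, locally path-connected and semi-locally simply connected Hausdorff topological space, and let $G$ be a finite group acting on $X$ by homeomorphisms (not necessarily freely or faithfully). Suppose that for every $g\in G$ the fixed locus $X^g=\{y\in X : gy=y\}$ has only finitely many path-connected components. Let $k\ge 1$, let $G$ act diagonally on $X^k=X\times\cdots\times X$, and let $x=(x_1,\dots,x_k)\in X^k$. Then the natural homomorphism $$\pi_1\big(X^k/G,[x]\big)\longrightarrow \prod_{i=1}^k \pi_1\big(X/G,[x_i]\big),$$ whose $i$-th component is induced by the map $X^k/G\to X/G$ coming from the $i$-th projection $X^k\to X$, has finite kernel, and its image is a subgroup of finite index. -/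

import Mathlib

/-- `X` is semi-locally simply connected: every point `x` has a neighbourhood `U` such that every
loop at `x` that stays in `U` is null-homotopic in `X`, i.e. `π₁(U, x) → π₁(X, x)` is trivial. -/
def SemilocallySimplyConnected (X : Type*) [TopologicalSpace X] : Prop :=
  ∀ x : X, ∃ U ∈ nhds x, ∀ γ : Path x x, Set.range γ ⊆ U → γ.Homotopic (Path.refl x)

/-- The orbit space `X / G`, with the quotient topology. -/
abbrev OrbitSpace (G X : Type*) [Group G] [MulAction G X] : Type _ :=
  MulAction.orbitRel.Quotient G X

/-- The class `[x]` of a point `x` in the orbit space `X / G`. -/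
abbrev OrbitSpace.mk (G : Type*) {X : Type*} [Group G] [MulAction G X] (x : X) : OrbitSpace G X :=
  Quotient.mk (MulAction.orbitRel G X) x

/-- The continuous map `X^ι / G → X / G`, `[x] ↦ [x i]`, induced by the `i`-th projection, where
`G` acts diagonally on `X^ι`. -/
def OrbitSpace.proj (G X : Type*) [Group G] [TopologicalSpace X] [MulAction G X]
    {ι : Type*} (i : ι) : C(OrbitSpace G (ι → X), OrbitSpace G X) where
  toFun := Quotient.map (fun x => x i) (by
    rintro _ y ⟨g, rfl⟩
    exact ⟨g, rfl⟩)
  continuous_toFun := (continuous_apply i).quotient_map' _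

/-- The natural homomorphism `π₁(X^ι / G, [x]) → ∏ i, π₁(X / G, [x i])` whose `i`-th component is
induced by the `i`-th projection. -/
noncomputable def OrbitSpace.piOneProj (G : Type*) {X : Type*} [Group G] [TopologicalSpace X]
    [MulAction G X] {ι : Type*} (x : ι → X) :
    FundamentalGroup (OrbitSpace G (ι → X)) (OrbitSpace.mk G x) →*
      ((i : ι) → FundamentalGroup (OrbitSpace G X) (OrbitSpace.mk G (x i))) :=
  MonoidHom.pi fun i => FundamentalGroup.map (OrbitSpace.proj G X i) (OrbitSpace.mk G x)

/-! Model the universal cover of `X` at `x` by homotopy classes of paths from `x`, and let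
`deckGroup G x` be the group of all lifts of elements of `G` to it, an extension of `G` by `π₁(X,
x)`. Sending a lift to the image in `X / G` of a path from the base point to its translate gives a
surjection onto `π₁(X / G)`; surjectivity is path lifting along `X → X / G`. Its kernel lies in the
subgroup generated by the elliptic elements, those with a fixed point: dividing the universal cover
by that subgroup leaves a separated local homeomorphism to `X / G`, to which the monodromy theorem
applies.

In the same way `π₁(X^k / G)` is a quotient of the fibre product over `G` of the groups `deckGroup G
(x i)`, and tuples with all coordinates elliptic die there. Two elliptic elements in one factor with
the same image in `G` therefore differ by an element which, placed in that coordinate, dies in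
`π₁(X^k / G)`. Modulo such elements each factor has only finitely many elliptic classes; they have
finite order and are stable under conjugation, so by Dietzmann's lemma they generate a finite group.
The kernel of the theorem embeds in the product of these finite groups. The image has finite index
because the fibre product has finite index in the full product, `G` being finite. -/

/-! ### Group theory: Dietzmann's lemma and fibre products over a finite group. -/

/-- **Dietzmann's lemma**: a finite set of elements of finite order that is closed under
conjugation generates a finite subgroup. -/
theorem Subgroup.finite_closure_of_conj {Γ : Type*} [Group Γ] {S : Set Γ} (hS : S.Finite)
    (hconj : ∀ g, ∀ s ∈ S, g * s * g⁻¹ ∈ S) (hord : ∀ s ∈ S, IsOfFinOrder s) :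
    Finite (Subgroup.closure S) := by
  classical
  set N := Subgroup.closure S with hN
  have : Finite S := hS
  have hSN : S ⊆ N := Subgroup.subset_closure
  let T : Set N := (↑) ⁻¹' S
  have hT : T.Finite := hS.preimage Subtype.val_injective.injOn
  have hTtop : Subgroup.closure T = ⊤ := Subgroup.closure_closure_coe_preimage
  have hfg : Group.FG N := ⟨⟨hT.toFinset, by simpa using hTtop⟩⟩
  -- the commutator of two elements only depends on their conjugation actions on `S`
  let c : N → (S → S) := fun n s => ⟨n * s * (n : Γ)⁻¹, hconj _ _ s.2⟩
  have hc : ∀ a b : N, c a = c b → b⁻¹ * a ∈ Subgroup.center N := by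
    intro a b hab
    have : (⊤ : Subgroup N) ≤ Subgroup.centralizer {b⁻¹ * a} := by
      rw [← hTtop, Subgroup.closure_le]
      intro t ht
      rw [SetLike.mem_coe, Subgroup.mem_centralizer_singleton_iff]
      have h1 := congrArg Subtype.val (congrFun hab ⟨t, ht⟩)
      simp only [c] at h1
      apply Subtype.ext
      push_cast
      have h2 : (a : Γ) * t = b * t * (b : Γ)⁻¹ * a := by rw [← h1]; group
      calc (t : Γ) * ((b : Γ)⁻¹ * a) = (b : Γ)⁻¹ * (b * t * (b : Γ)⁻¹ * a) := by group
        _ = (b : Γ)⁻¹ * a * t := by rw [← h2]; group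
    rw [Subgroup.mem_center_iff]
    intro g
    exact Subgroup.mem_centralizer_singleton_iff.1 (this (Subgroup.mem_top g))
  have hcomm : ∀ a b a' b' : N, c a = c a' → c b = c b' →
      a * b * a⁻¹ * b⁻¹ = a' * b' * a'⁻¹ * b'⁻¹ := by
    intro a b a' b' h1 h2
    obtain ⟨z, hz, rfl⟩ : ∃ z ∈ Subgroup.center N, a = a' * z := ⟨_, hc _ _ h1, by group⟩
    obtain ⟨w, hw, rfl⟩ : ∃ z ∈ Subgroup.center N, b = b' * z := ⟨_, hc _ _ h2, by group⟩
    rw [Subgroup.mem_center_iff] at hz hw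
    simp only [mul_inv_rev]
    calc a' * z * (b' * w) * (z⁻¹ * a'⁻¹) * (w⁻¹ * b'⁻¹)
        = a' * (z * (b' * w)) * z⁻¹ * a'⁻¹ * w⁻¹ * b'⁻¹ := by group
      _ = a' * b' * w * a'⁻¹ * w⁻¹ * b'⁻¹ := by rw [← hz]; group
      _ = a' * b' * (a'⁻¹ * w) * w⁻¹ * b'⁻¹ := by rw [hw a'⁻¹]; group
      _ = a' * b' * a'⁻¹ * b'⁻¹ := by group
  have hfin : Finite (commutatorSet N) := by
    have : (Set.range fun p : N × N => (c p.1, c p.2)).Finite := Set.toFinite _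
    refine Set.Finite.subset ((Set.finite_range fun q : (S → S) × (S → S) =>
      if h : ∃ a b : N, c a = q.1 ∧ c b = q.2 then
        h.choose * h.choose_spec.choose * h.choose⁻¹ * h.choose_spec.choose⁻¹ else 1)) ?_
    rintro _ ⟨a, b, rfl⟩
    refine ⟨(c a, c b), ?_⟩
    have h : ∃ a' b' : N, c a' = c a ∧ c b' = c b := ⟨a, b, rfl, rfl⟩
    simp only [dif_pos h]
    exact hcomm _ _ _ _ h.choose_spec.choose_spec.1 h.choose_spec.choose_spec.2
  have hab : Finite (Abelianization N) := by
    have : Group.FG (Abelianization N) :=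
      Group.fg_of_surjective (f := Abelianization.of) (QuotientGroup.mk'_surjective _)
    refine CommGroup.finite_of_fg_isMulTorsion (G := Abelianization N) ?_
    have key : ∀ x : N, IsOfFinOrder (Abelianization.of x) := by
      intro x
      have hx : x ∈ Subgroup.closure T := hTtop ▸ Subgroup.mem_top x
      induction hx using Subgroup.closure_induction with
      | mem t ht =>
        exact MonoidHom.isOfFinOrder _ ((Submonoid.isOfFinOrder_coe (x := t)).1 (hord _ ht))
      | one => simp
      | mul a b _ _ ha hb => rw [map_mul]; exact ha.mul hb
      | inv a _ ha => rw [map_inv]; exact ha.inv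
    intro a
    obtain ⟨x, rfl⟩ := QuotientGroup.mk'_surjective _ a
    exact key x
  have : Finite (N ⧸ _root_.commutator N) := hab
  -- Schur: a group with finitely many commutators has finite commutator subgroup. The quotient by
  -- it is the abelianization, finitely generated and torsion.
  exact Finite.of_subgroup_quotient (_root_.commutator N)

/-- A homomorphism from a subgroup of a finite product that kills the elements of `K i` placed in
the `i`-th coordinate also kills every tuple whose `i`-th coordinate lies in `K i`. -/
theorem map_eq_one_of_forall_mulSingle {ι D : Type*} [Finite ι] [DecidableEq ι] {Γ : ι → Type*}
    [∀ i, Group (Γ i)] [Group D] {F : Subgroup (∀ i, Γ i)} (φ : F →* D)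
    (K : ∀ i, Set (Γ i))
    (hK : ∀ i, ∀ γ ∈ K i, ∃ h : Pi.mulSingle i γ ∈ F, φ ⟨_, h⟩ = 1)
    (δ : F) (hδ : ∀ i, δ.1 i ∈ K i) : φ δ = 1 := by
  have := Fintype.ofFinite ι
  suffices H : ∀ s : Finset ι, ∀ δ : F, (∀ i ∈ s, δ.1 i ∈ K i) → (∀ i ∉ s, δ.1 i = 1) →
      φ δ = 1 from H Finset.univ δ (fun i _ => hδ i) (by simp)
  intro s
  induction s using Finset.induction_on with
  | empty =>
    intro δ _ h
    have : δ = 1 := Subtype.ext (funext fun i => h i (by simp))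
    rw [this, map_one]
  | insert a s ha ih =>
    intro δ h1 h2
    obtain ⟨hm, hm'⟩ := hK a _ (h1 a (Finset.mem_insert_self _ _))
    have h3 : φ (⟨_, hm⟩⁻¹ * δ) = 1 := by
      refine ih _ (fun i hi => ?_) (fun i hi => ?_)
      · have hia : i ≠ a := fun h => ha (h ▸ hi)
        simpa [Pi.mulSingle_eq_of_ne hia] using h1 i (Finset.mem_insert_of_mem hi)
      · by_cases hia : i = a
        · subst hia; simp
        · simpa [Pi.mulSingle_eq_of_ne hia] using h2 i (by simp [hia, hi])
    rwa [map_mul, map_inv, hm', inv_one, one_mul] at h3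

/-- The fibre product over `G` of a family of groups `Γ i` over `G`. -/
def fibreProduct {ι G : Type*} {Γ : ι → Type*} [Group G] [∀ i, Group (Γ i)]
    (ρ : ∀ i, Γ i →* G) : Subgroup (∀ i, Γ i) where
  carrier := {γ | ∃ g, ∀ i, ρ i (γ i) = g}
  one_mem' := ⟨1, by simp⟩
  mul_mem' := by
    rintro a b ⟨g, hg⟩ ⟨h, hh⟩
    exact ⟨g * h, by simp [hg, hh]⟩
  inv_mem' := by
    rintro a ⟨g, hg⟩
    exact ⟨g⁻¹, by simp [hg]⟩

/-- The group-theoretic core. In the application `Γ i` is a deck group, `E i` its elliptic elements,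
`D` and `D' i` are the fundamental groups of the orbit spaces, and `P` is the natural homomorphism.
-/
theorem finite_ker_and_finiteIndex_range {ι G D : Type*} [Finite ι] {Γ D' : ι → Type*} [Group G]
    [Finite G] [∀ i, Group (Γ i)] [Group D] [∀ i, Group (D' i)] (ρ : ∀ i, Γ i →* G)
    (φ : fibreProduct ρ →* D) (ψ : ∀ i, Γ i →* D' i) (P : D →* ∀ i, D' i)
    (E : ∀ i, Set (Γ i))
    (hφ : Function.Surjective φ) (hψ : ∀ i, Function.Surjective (ψ i))
    (hP : ∀ γ i, P (φ γ) i = ψ i (γ.1 i))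
    (hρ : ∀ i, Function.Surjective (ρ i))
    (hEconj : ∀ i g, ∀ s ∈ E i, g * s * g⁻¹ ∈ E i)
    (hEord : ∀ i, ∀ s ∈ E i, IsOfFinOrder s)
    (hEρ : ∀ i j, ∀ s ∈ E i, ∃ t ∈ E j, ρ j t = ρ i s)
    (hker : ∀ i, (ψ i).ker ≤ Subgroup.closure (E i))
    (hE : ∀ γ : fibreProduct ρ, (∀ i, γ.1 i ∈ E i) → φ γ = 1) :
    Finite P.ker ∧ P.range.FiniteIndex := by
  classical
  have hmem : ∀ i (γ : Γ i), ρ i γ = 1 → Pi.mulSingle i γ ∈ fibreProduct ρ := by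
    intro i γ h
    refine ⟨1, fun j => ?_⟩
    by_cases hj : j = i
    · subst hj; simpa using h
    · simp [Pi.mulSingle_eq_of_ne hj]
  have hext : ∀ i (γ : Γ i), ∃ γ' : fibreProduct ρ, γ'.1 i = γ := by
    intro i γ
    choose f hf using fun j => hρ j (ρ i γ)
    refine ⟨⟨Function.update f i γ, ρ i γ, fun j => ?_⟩, by simp⟩
    by_cases hj : j = i
    · subst hj; simp
    · simp [hj, hf]
  -- the kernel of `φ` on the `i`-th factor
  let K : ∀ i, Subgroup (Γ i) := fun i =>
    { carrier := {γ | ∃ h : ρ i γ = 1, φ ⟨_, hmem i γ h⟩ = 1}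
      one_mem' := ⟨map_one _, by
        rw [← map_one φ]; congr 1; exact Subtype.ext (Pi.mulSingle_one i)⟩
      mul_mem' := by
        rintro a b ⟨ha, ha'⟩ ⟨hb, hb'⟩
        refine ⟨by simp [ha, hb], ?_⟩
        have h := map_mul φ ⟨_, hmem i a ha⟩ ⟨_, hmem i b hb⟩
        rw [ha', hb', one_mul] at h
        rw [← h]
        congr 1
        exact Subtype.ext (Pi.mulSingle_mul i a b)
      inv_mem' := by
        rintro a ⟨ha, ha'⟩
        refine ⟨by simp [ha], ?_⟩
        have h := map_inv φ ⟨_, hmem i a ha⟩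
        rw [ha', inv_one] at h
        rw [← h]
        congr 1
        exact Subtype.ext (Pi.mulSingle_inv i a) }
  -- A conjugator in `Γ i` extends to the fibre product by surjectivity of the `ρ j`, and the other
  -- coordinates cancel.
  have hKn : ∀ i, (K i).Normal := by
    refine fun i => ⟨?_⟩
    rintro n ⟨hn, hn'⟩ g
    obtain ⟨γ, rfl⟩ := hext i g
    refine ⟨by simp [hn], ?_⟩
    have : φ (γ * ⟨_, hmem i n hn⟩ * γ⁻¹) = 1 := by simp [hn']
    rw [← this]
    congr 1
    refine Subtype.ext (funext fun j => ?_)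
    by_cases hj : j = i
    · subst hj; simp
    · simp [Pi.mulSingle_eq_of_ne hj]
  -- Complete `a` and `b` by the same entries of the `E j`: both tuples are killed by `φ`, and their
  -- quotient is `a⁻¹ * b` in the single coordinate `i`.
  have hEK : ∀ i, ∀ a ∈ E i, ∀ b ∈ E i, ρ i a = ρ i b → a⁻¹ * b ∈ K i := by
    intro i a ha b hb hab
    choose t ht ht' using fun j => hEρ i j a ha
    have h1 : ∀ c, c ∈ E i → ρ i c = ρ i a → ∃ h : Function.update t i c ∈ fibreProduct ρ,
        φ ⟨_, h⟩ = 1 := by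
      intro c hc hca
      refine ⟨⟨ρ i a, fun j => ?_⟩, hE _ fun j => ?_⟩
      · by_cases hj : j = i
        · subst hj; simpa using hca
        · simp [hj, ht']
      · by_cases hj : j = i
        · subst hj; simpa using hc
        · simp [hj, ht]
    obtain ⟨ma, ha'⟩ := h1 a ha rfl
    obtain ⟨mb, hb'⟩ := h1 b hb hab.symm
    refine ⟨by simp [hab], ?_⟩
    have : φ (⟨_, ma⟩⁻¹ * ⟨_, mb⟩) = 1 := by rw [map_mul, map_inv, ha', hb']; simp
    rw [← this]
    congr 1
    refine Subtype.ext (funext fun j => ?_)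
    by_cases hj : j = i
    · subst hj; simp
    · simp [hj]
  -- By `hEK` each element of `G` accounts for at most one class of `E i` modulo `K i`; elements of
  -- `G` not hit by `E i` get the junk value `1`.
  have hQfin : ∀ i, Finite (Subgroup.closure (QuotientGroup.mk' (K i) '' E i)) := by
    intro i
    refine Subgroup.finite_closure_of_conj ?_ ?_ ?_
    · have : (Set.range fun s : E i => ρ i s).Finite := Set.toFinite _
      refine Set.Finite.subset (Set.finite_range fun g : G =>
        if h : ∃ s ∈ E i, ρ i s = g then QuotientGroup.mk' (K i) h.choose else 1) ?_
      rintro _ ⟨s, hs, rfl⟩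
      have h : ∃ s' ∈ E i, ρ i s' = ρ i s := ⟨s, hs, rfl⟩
      refine ⟨ρ i s, ?_⟩
      simp only [dif_pos h]
      exact QuotientGroup.eq.2 (hEK i _ h.choose_spec.1 s hs h.choose_spec.2)
    · rintro g _ ⟨s, hs, rfl⟩
      obtain ⟨g, rfl⟩ := QuotientGroup.mk'_surjective (K i) g
      exact ⟨g * s * g⁻¹, hEconj i g s hs, by simp⟩
    · rintro _ ⟨s, hs, rfl⟩
      exact MonoidHom.isOfFinOrder _ (hEord i s hs)
  constructor
  -- A lift of an element of `ker P` has coordinates in the kernels of the `ψ i`. Its classes modulo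
  -- the `K i` lie in finite groups and determine the element.
  · have h1 : ∀ d : P.ker, ∃ γ : fibreProduct ρ, φ γ = d := fun d => hφ d
    choose γ hγ using h1
    have h2 : ∀ (d : P.ker) i, QuotientGroup.mk' (K i) ((γ d).1 i) ∈
        Subgroup.closure (QuotientGroup.mk' (K i) '' E i) := by
      intro d i
      rw [← MonoidHom.map_closure]
      refine ⟨_, hker i ?_, rfl⟩
      rw [MonoidHom.mem_ker, ← hP, hγ, MonoidHom.mem_ker.1 d.2, Pi.one_apply]
    refine Finite.of_injective (β := ∀ i, Subgroup.closure (QuotientGroup.mk' (K i) '' E i))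
      (fun d i => ⟨_, h2 d i⟩) ?_
    intro a b hab
    apply Subtype.ext
    rw [← hγ a, ← hγ b, ← inv_mul_eq_one, ← map_inv, ← map_mul]
    refine map_eq_one_of_forall_mulSingle φ (fun i => (K i : Set (Γ i))) ?_ _ fun i => ?_
    · rintro i x ⟨hx, hx'⟩
      exact ⟨_, hx'⟩
    · exact QuotientGroup.eq.1 (congrArg Subtype.val (congrFun hab i))
  · let Ψ : (∀ i, Γ i) →* ∀ i, D' i := MonoidHom.pi fun i => (ψ i).comp (Pi.evalMonoidHom _ i)
    have hΨ : Function.Surjective Ψ := by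
      intro d
      choose f hf using fun i => hψ i (d i)
      exact ⟨f, funext hf⟩
    -- The fibre product contains the kernel of a homomorphism to the finite group `ι → G`.
    let R : (∀ i, Γ i) →* (ι → G) := MonoidHom.pi fun i => (ρ i).comp (Pi.evalMonoidHom _ i)
    have hR : R.ker ≤ fibreProduct ρ := fun γ h => ⟨1, fun i => congrFun h i⟩
    have h1 : (fibreProduct ρ).FiniteIndex := Subgroup.finiteIndex_of_le hR
    have h2 : ((fibreProduct ρ).map Ψ).FiniteIndex := by
      refine ⟨fun h => h1.index_ne_zero ?_⟩
      have := Subgroup.index_map_dvd (fibreProduct ρ) hΨ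
      rw [h] at this
      exact Nat.eq_zero_of_zero_dvd this
    refine Subgroup.finiteIndex_of_le (H := (fibreProduct ρ).map Ψ) ?_
    rintro _ ⟨γ, hγ, rfl⟩
    exact ⟨φ ⟨γ, hγ⟩, funext fun i => hP ⟨γ, hγ⟩ i⟩

open Filter Topology Set

/-! ### Lifting paths through the quotient by a finite group. -/

section PathLifting

variable {G Y : Type*} [Group G] [TopologicalSpace Y] [MulAction G Y]

/-- The selection `σ : ℝ → Y` of points of `H`-orbits can be made continuous on `s`. -/
def Liftable (H : Subgroup G) (σ : ℝ → Y) (s : Set ℝ) : Prop :=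
  ∃ τ : ℝ → Y, ContinuousOn τ s ∧ ∀ t ∈ s, ∃ h ∈ H, τ t = h • σ t

theorem Liftable.mono {H : Subgroup G} {σ : ℝ → Y} {s t : Set ℝ} (h : Liftable H σ t)
    (hst : s ⊆ t) : Liftable H σ s :=
  let ⟨τ, h1, h2⟩ := h
  ⟨τ, h1.mono hst, fun u hu => h2 u (hst hu)⟩

theorem continuousOn_ite_le {τ₁ τ₂ : ℝ → Y} {a b c : ℝ} (h₁ : ContinuousOn τ₁ (Icc a b))
    (h₂ : ContinuousOn τ₂ (Icc b c)) (h : τ₁ b = τ₂ b) :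
    ContinuousOn (fun t => if t ≤ b then τ₁ t else τ₂ t) (Icc a c) := by
  refine ContinuousOn.if (fun t ht => ?_) (h₁.mono ?_) (h₂.mono ?_)
  · have : t = b := by
      have := frontier_le_subset_eq continuous_id continuous_const ht.2
      simpa using this
    rw [this, h]
  · rintro t ⟨ht, ht'⟩
    have : closure {a : ℝ | a ≤ b} = Iic b := closure_Iic b
    rw [this] at ht'
    exact ⟨ht.1, ht'⟩
  · rintro t ⟨ht, ht'⟩
    have : closure {a : ℝ | ¬ a ≤ b} = Ici b := by simp only [not_le]; exact closure_Ioi b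
    rw [this] at ht'
    exact ⟨ht', ht.2⟩

variable [ContinuousConstSMul G Y]

/-- Translating a selection by a constant element of `H` prescribes its value at one point, so that
selections on adjacent intervals can be glued. -/
theorem Liftable.exists_apply_eq {H : Subgroup G} {σ : ℝ → Y} {s : Set ℝ} (hl : Liftable H σ s)
    {t : ℝ} (ht : t ∈ s) {y : Y} (hy : ∃ h ∈ H, y = h • σ t) :
    ∃ τ : ℝ → Y, ContinuousOn τ s ∧ (∀ t ∈ s, ∃ h ∈ H, τ t = h • σ t) ∧ τ t = y := by
  obtain ⟨τ, h1, h2⟩ := hl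
  obtain ⟨h, hh, rfl⟩ := hy
  obtain ⟨k, hk, hk'⟩ := h2 t ht
  refine ⟨fun u => (h * k⁻¹) • τ u, h1.const_smul _, fun u hu => ?_, ?_⟩
  · obtain ⟨l, hl, hl'⟩ := h2 u hu
    exact ⟨h * k⁻¹ * l, H.mul_mem (H.mul_mem hh (H.inv_mem hk)) hl, by simp [hl', mul_smul]⟩
  · simp [hk', mul_smul]

theorem Liftable.extend_right {H : Subgroup G} {σ : ℝ → Y} {a b c : ℝ} (hab : a ≤ b) (hbc : b ≤ c)
    (hl : Liftable H σ (Icc b c)) {τ : ℝ → Y} (hτ : ContinuousOn τ (Icc a b))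
    (hτ' : ∀ t ∈ Icc a b, ∃ h ∈ H, τ t = h • σ t) :
    ∃ τ' : ℝ → Y, ContinuousOn τ' (Icc a c) ∧ (∀ t ∈ Icc a c, ∃ h ∈ H, τ' t = h • σ t) ∧
      EqOn τ' τ (Icc a b) := by
  obtain ⟨ρ, h1, h2, h3⟩ := hl.exists_apply_eq (left_mem_Icc.2 hbc) (hτ' b (right_mem_Icc.2 hab))
  refine ⟨_, continuousOn_ite_le hτ h1 h3.symm, fun t ht => ?_, fun t ht => if_pos ht.2⟩
  split_ifs with h
  · exact hτ' t ⟨ht.1, h⟩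
  · exact h2 t ⟨(not_le.1 h).le, ht.2⟩

theorem Liftable.extend_left {H : Subgroup G} {σ : ℝ → Y} {a b c : ℝ} (hab : a ≤ b) (hbc : b ≤ c)
    (hl : Liftable H σ (Icc a b)) {τ : ℝ → Y} (hτ : ContinuousOn τ (Icc b c))
    (hτ' : ∀ t ∈ Icc b c, ∃ h ∈ H, τ t = h • σ t) :
    ∃ τ' : ℝ → Y, ContinuousOn τ' (Icc a c) ∧ (∀ t ∈ Icc a c, ∃ h ∈ H, τ' t = h • σ t) ∧
      EqOn τ' τ (Icc b c) := by
  obtain ⟨ρ, h1, h2, h3⟩ := hl.exists_apply_eq (right_mem_Icc.2 hab) (hτ' b (left_mem_Icc.2 hbc))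
  refine ⟨_, continuousOn_ite_le h1 hτ h3, fun t ht => ?_, fun t ht => ?_⟩
  · split_ifs with h
    · exact h2 t ⟨ht.1, h⟩
    · exact hτ' t ⟨(not_le.1 h).le, ht.2⟩
  · rcases ht.1.eq_or_lt with rfl | h
    · simp [h3]
    · simp [not_le.2 h]

theorem liftable_Icc {H : Subgroup G} {σ : ℝ → Y} {a b : ℝ} (hab : a ≤ b)
    (hloc : ∀ t ∈ Icc a b, ∃ u ∈ 𝓝 t, Liftable H σ u) : Liftable H σ (Icc a b) := by
  choose u hu hlift using fun t : Icc a b => hloc t t.2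
  obtain ⟨t, h0, hmono, ⟨m, hm⟩, hsub⟩ := exists_monotone_Icc_subset_open_cover_Icc hab
    (c := fun i : Icc a b => (↑) ⁻¹' interior (u i))
    (fun i => isOpen_interior.preimage continuous_subtype_val)
    (fun i _ => mem_iUnion.2 ⟨i, mem_interior_iff_mem_nhds.2 (hu i)⟩)
  suffices h : ∀ n, Liftable H σ (Icc a (t n)) by
    have := h m
    rwa [hm m le_rfl] at this
  intro n
  induction n with
  | zero =>
    rw [h0]
    refine ⟨σ, by rw [Icc_self]; exact continuousOn_singleton _ _, fun s _ => ⟨1, H.one_mem, ?_⟩⟩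
    simp
  | succ n ih =>
    obtain ⟨i, hi⟩ := hsub n
    have hl : Liftable H σ (Icc (t n : ℝ) (t (n + 1))) := by
      refine (hlift i).mono fun s hs => interior_subset ?_
      exact hi (show (⟨s, (t n).2.1.trans hs.1, hs.2.trans (t (n + 1)).2.2⟩ : Icc a b) ∈
        Icc (t n) (t (n + 1)) from ⟨hs.1, hs.2⟩)
    obtain ⟨τ, h1, h2⟩ := ih
    obtain ⟨τ', h1', h2', -⟩ := hl.extend_right (t n).2.1 (hmono n.le_succ) h1 h2
    exact ⟨τ', h1', h2'⟩

/-- Continuous selections over an open interval exist as soon as they exist locally: exhaust the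
interval by compact ones. -/
theorem liftable_of_isOpen_of_ordConnected {H : Subgroup G} {σ : ℝ → Y} {s : Set ℝ}
    (hs : IsOpen s) (hoc : OrdConnected s)
    (hloc : ∀ t ∈ s, ∃ u ∈ 𝓝 t, Liftable H σ u) : Liftable H σ s := by
  rcases s.eq_empty_or_nonempty with rfl | ⟨p, hp⟩
  · exact ⟨σ, continuousOn_empty _, by simp⟩
  have : Nonempty s := ⟨⟨p, hp⟩⟩
  let d : ℕ → s := TopologicalSpace.denseSeq s
  -- Continuous selections on compact subintervals of `s`. Extending them successively to contain
  -- each point of a dense sequence exhausts `s`.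
  let St := {q : ℝ × ℝ × (ℝ → Y) // q.1 ≤ q.2.1 ∧ q.1 ∈ s ∧ q.2.1 ∈ s ∧
    ContinuousOn q.2.2 (Icc q.1 q.2.1) ∧ ∀ t ∈ Icc q.1 q.2.1, ∃ h ∈ H, q.2.2 t = h • σ t}
  have step : ∀ (q : St) (n : ℕ), ∃ q' : St, q'.1.1 ≤ q.1.1 ∧ q.1.2.1 ≤ q'.1.2.1 ∧
      q'.1.1 ≤ d n ∧ d n ≤ q'.1.2.1 ∧ EqOn q'.1.2.2 q.1.2.2 (Icc q.1.1 q.1.2.1) := by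
    rintro ⟨⟨a, b, τ⟩, hab, ha, hb, h1, h2⟩ n
    dsimp only at *
    have hc : max b (d n) ∈ s := by
      rcases max_choice b (d n) with h | h <;> rw [h]
      · exact hb
      · exact (d n).2
    have hc' : min a (d n) ∈ s := by
      rcases min_choice a (d n) with h | h <;> rw [h]
      · exact ha
      · exact (d n).2
    have hl : ∀ {x y}, x ∈ s → y ∈ s → x ≤ y → Liftable H σ (Icc x y) := fun hx hy hxy =>
      liftable_Icc hxy fun t ht => hloc t (hoc.out hx hy ht)
    obtain ⟨τ₁, h3, h4, h5⟩ := (hl hb hc (le_max_left _ _)).extend_right hab (le_max_left _ _) h1 h2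
    obtain ⟨τ₂, h6, h7, h8⟩ := (hl hc' ha (min_le_left _ _)).extend_left (min_le_left _ _)
      (hab.trans (le_max_left _ _)) h3 h4
    refine ⟨⟨⟨min a (d n), max b (d n), τ₂⟩, ?_, hc', hc, h6, h7⟩, min_le_left _ _, le_max_left _ _,
      min_le_right _ _, le_max_right _ _, ?_⟩
    · exact (min_le_left _ _).trans (hab.trans (le_max_left _ _))
    · intro t ht
      exact (h8 ⟨ht.1, ht.2.trans (le_max_left _ _)⟩).trans (h5 ht)
  choose f hf1 hf2 hf3 hf4 hf5 using step
  let q0 : St := ⟨⟨p, p, σ⟩, le_rfl, hp, hp, by rw [Icc_self]; exact continuousOn_singleton _ _,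
    fun t _ => ⟨1, H.one_mem, by simp⟩⟩
  let q : ℕ → St := fun n => Nat.rec q0 (fun n q => f q n) n
  have hq : ∀ n, q (n + 1) = f (q n) n := fun n => rfl
  have hanti : Antitone fun n => (q n).1.1 := antitone_nat_of_succ_le fun n => hf1 _ _
  have hmono : Monotone fun n => (q n).1.2.1 := monotone_nat_of_le_succ fun n => hf2 _ _
  have heq : ∀ m n, m ≤ n → EqOn (q n).1.2.2 (q m).1.2.2 (Icc (q m).1.1 (q m).1.2.1) := by
    intro m n hmn
    induction n, hmn using Nat.le_induction with
    | base => exact fun _ _ => rfl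
    | succ n hmn ih =>
      intro t ht
      exact (hf5 (q n) n ⟨(hanti hmn).trans ht.1, ht.2.trans (hmono hmn)⟩).trans (ih ht)
  have hex : ∀ t ∈ s, ∃ n, t ∈ Ioo (q n).1.1 (q n).1.2.1 := by
    intro t ht
    have h1 : ∃ i, (d i : ℝ) < t := by
      obtain ⟨l, hl, hl'⟩ := exists_Ioc_subset_of_mem_nhds (hs.mem_nhds ht) (exists_lt t)
      obtain ⟨i, hi⟩ := (TopologicalSpace.denseRange_denseSeq s).exists_mem_open
        (isOpen_Ioo (a := l) (b := t) |>.preimage continuous_subtype_val)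
        (by obtain ⟨m, hm, hm'⟩ := exists_between hl
            exact ⟨⟨m, hl' ⟨hm, hm'.le⟩⟩, hm, hm'⟩)
      exact ⟨i, hi.2⟩
    have h2 : ∃ i, t < (d i : ℝ) := by
      obtain ⟨l, hl, hl'⟩ := exists_Ico_subset_of_mem_nhds (hs.mem_nhds ht) (exists_gt t)
      obtain ⟨i, hi⟩ := (TopologicalSpace.denseRange_denseSeq s).exists_mem_open
        (isOpen_Ioo (a := t) (b := l) |>.preimage continuous_subtype_val)
        (by obtain ⟨m, hm, hm'⟩ := exists_between hl
            exact ⟨⟨m, hl' ⟨hm.le, hm'⟩⟩, hm, hm'⟩)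
      exact ⟨i, hi.1⟩
    obtain ⟨i, hi⟩ := h1
    obtain ⟨j, hj⟩ := h2
    -- The stage `q (n + 1)` is the first one required to contain `d n`.
    refine ⟨max i j + 1, ?_, ?_⟩
    · exact ((hanti (Nat.succ_le_succ (le_max_left i j))).trans (hf3 (q i) i)).trans_lt hi
    · exact hj.trans_le ((hf4 (q j) j).trans (hmono (Nat.succ_le_succ (le_max_right i j))))
  choose! N hN using hex
  refine ⟨fun t => (q (N t)).1.2.2 t, fun t ht => ?_, fun t ht => ?_⟩
  · have h1 : ContinuousAt (q (N t)).1.2.2 t :=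
      (q (N t)).2.2.2.2.1.continuousAt (Icc_mem_nhds (hN t ht).1 (hN t ht).2)
    refine (h1.congr ?_).continuousWithinAt
    filter_upwards [hs.mem_nhds ht, Icc_mem_nhds (hN t ht).1 (hN t ht).2] with u hu hu'
    rcases le_total (N u) (N t) with h | h
    · exact heq _ _ h (Ioo_subset_Icc_self (hN u hu))
    · exact (heq _ _ h hu').symm
  · exact (q (N t)).2.2.2.2.2 t (Ioo_subset_Icc_self (hN t ht))

theorem exists_isOpen_forall_smul_notMem [Finite G] [T2Space Y] (y : Y) :
    ∃ V : Set Y, IsOpen V ∧ y ∈ V ∧ ∀ g : G, g • y ≠ y → ∀ v ∈ V, g • v ∉ V := by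
  have h1 : ∀ g : G, ∃ V : Set Y, IsOpen V ∧ y ∈ V ∧ (g • y ≠ y → ∀ v ∈ V, g • v ∉ V) := by
    intro g
    by_cases hg : g • y = y
    · exact ⟨univ, isOpen_univ, mem_univ _, fun h => absurd hg h⟩
    · obtain ⟨A, B, hA, hB, hA', hB', hAB⟩ := t2_separation hg
      refine ⟨B ∩ (g • ·) ⁻¹' A, hB.inter (hA.preimage (continuous_const_smul g)),
        ⟨hB', hA'⟩, fun _ v hv hv' => ?_⟩
      exact disjoint_left.1 hAB hv.2 hv'.1
  choose V hV1 hV2 hV3 using h1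
  exact ⟨⋂ g, V g, isOpen_iInter_of_finite hV1, mem_iInter.2 hV2, fun g hg v hv hv' =>
    hV3 g hg v (mem_iInter.1 hv g) (mem_iInter.1 hv' g)⟩

/-- A selection of points of `H`-orbits that is continuous as a map to `Y / H` on an open interval
can be replaced by a continuous one. -/
theorem liftable_of_eventually [Finite G] [T2Space Y] (H : Subgroup G) (σ : ℝ → Y) {s : Set ℝ}
    (hs : IsOpen s) (hσ : ∀ t ∈ s, ∀ V ∈ 𝓝 (σ t), ∀ᶠ u in 𝓝 t, ∃ h ∈ H, h • σ u ∈ V) :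
    Liftable H σ s := by
  classical
  have := Fintype.ofFinite G
  induction hn : Nat.card H using Nat.strong_induction_on generalizing H σ s with
  | _ n ih =>
  subst hn
  -- Off `O` the point `σ t` is fixed by all of `H` and continuity will be automatic; on `O` a
  -- proper subgroup of `H` suffices locally.
  let O : Set ℝ := {t ∈ s | ∃ h ∈ H, h • σ t ≠ σ t}
  have hloc : ∀ t ∈ O, ∃ u ∈ 𝓝 t, u ⊆ O ∧ Liftable H σ u := by
    rintro t ⟨hts, k, hkH, hk⟩
    obtain ⟨V, hVo, hVt, hVd⟩ := exists_isOpen_forall_smul_notMem (G := G) (σ t)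
    obtain ⟨u, hu, huo, htu⟩ := eventually_nhds_iff.1
      ((hσ t hts V (hVo.mem_nhds hVt)).and (hs.mem_nhds hts))
    let K : Subgroup G := H ⊓ MulAction.stabilizer G (σ t)
    have hKlt : Nat.card K < Nat.card H := by
      have hle : K ≤ H := inf_le_left
      refine lt_of_le_of_ne (Nat.card_mono (toFinite _) hle) fun h => hk ?_
      have : K = H := Subgroup.eq_of_le_of_card_ge hle h.ge
      have hkK : k ∈ K := this ▸ hkH
      exact hkK.2
    choose! c hcH hcV using fun x hx => (hu x hx).1
    let σ' : ℝ → Y := fun x => c x • σ x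
    have hlift : Liftable K σ' u := by
      refine ih _ hKlt K σ' huo (fun x hx W hW => ?_) rfl
      have hx' : x ∈ s := (hu x hx).2
      have hW' : (c x • ·) ⁻¹' (W ∩ V) ∈ 𝓝 (σ x) :=
        (continuous_const_smul (c x)).continuousAt (inter_mem hW (hVo.mem_nhds (hcV x hx)))
      filter_upwards [hσ x hx' _ hW', huo.mem_nhds hx] with y ⟨h, hh, hhy⟩ hyu
      -- This element carries `c y • σ y ∈ V` back into `V`, so by the choice of `V` it stabilizes
      -- `σ t`.
      refine ⟨c x * h * (c y)⁻¹, ⟨H.mul_mem (H.mul_mem (hcH x hx) hh) (H.inv_mem (hcH y hyu)), ?_⟩,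
        ?_⟩
      · by_contra hne
        refine hVd _ hne _ (hcV y hyu) ?_
        have := hhy.2
        simpa [mul_smul] using this
      · have := hhy.1
        simpa [σ', mul_smul] using this
    refine ⟨u, huo.mem_nhds htu, fun x hx => ⟨(hu x hx).2, ?_⟩, ?_⟩
    · refine ⟨(c x)⁻¹ * k * c x, H.mul_mem (H.mul_mem (H.inv_mem (hcH x hx)) hkH) (hcH x hx),
        fun h => hVd k hk _ (hcV x hx) ?_⟩
      have h' : k • c x • σ x = c x • σ x := by
        rw [mul_assoc, mul_smul, mul_smul, inv_smul_eq_iff] at h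
        exact h
      rw [h']
      exact hcV x hx
    · obtain ⟨τ, h1, h2⟩ := hlift
      refine ⟨τ, h1, fun x hx => ?_⟩
      obtain ⟨h, hh, hhx⟩ := h2 x hx
      exact ⟨h * c x, H.mul_mem hh.1 (hcH x hx), by rw [hhx, mul_smul]⟩
  have hOo : IsOpen O := isOpen_iff_mem_nhds.2 fun t ht =>
    let ⟨u, hu, huO, _⟩ := hloc t ht
    mem_of_superset hu huO
  have hcomp_open : ∀ p, IsOpen (ordConnectedComponent O p) := by
    refine fun p => isOpen_iff_mem_nhds.2 fun t ht => ?_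
    rw [ordConnectedComponent_eq (mem_ordConnectedComponent.1 ht), ordConnectedComponent_mem_nhds]
    exact hOo.mem_nhds (ordConnectedComponent_subset ht)
  have hcomp : ∀ p, Liftable H σ (ordConnectedComponent O p) := fun p =>
    liftable_of_isOpen_of_ordConnected (hcomp_open p) inferInstance fun t ht =>
      let ⟨u, hu, _, hl⟩ := hloc t (ordConnectedComponent_subset ht)
      ⟨u, hu, hl⟩
  choose L hL1 hL2 using hcomp
  let τ : ℝ → Y := fun t => if h : t ∈ O then L (ordConnectedProj O ⟨t, h⟩) t else σ t
  have hτH : ∀ t, ∃ h ∈ H, τ t = h • σ t := by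
    intro t
    by_cases ht : t ∈ O
    · simp only [τ, dif_pos ht]
      exact hL2 _ t (mem_ordConnectedComponent_ordConnectedProj O ⟨t, ht⟩)
    · exact ⟨1, H.one_mem, by simp [τ, dif_neg ht]⟩
  refine ⟨τ, fun t hts => ContinuousAt.continuousWithinAt ?_, fun t _ => hτH t⟩
  by_cases ht : t ∈ O
  · set p := ordConnectedProj O ⟨t, ht⟩ with hp
    have hmem := mem_ordConnectedComponent_ordConnectedProj O ⟨t, ht⟩
    refine ((hL1 p).continuousAt ((hcomp_open p).mem_nhds hmem)).congr ?_
    filter_upwards [(hcomp_open p).mem_nhds hmem] with u hu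
    have huO : u ∈ O := ordConnectedComponent_subset hu
    simp only [τ, dif_pos huO]
    congr 1
    rw [hp, ordConnectedProj_eq, ← mem_ordConnectedComponent,
      ← ordConnectedComponent_ordConnectedProj]
    exact hu
  · have hfix : ∀ h ∈ H, h • σ t = σ t := by
      intro h hh
      by_contra hne
      exact ht ⟨hts, h, hh, hne⟩
    have hτt : τ t = σ t := dif_neg ht
    refine continuousAt_def.2 fun V hV => ?_
    rw [hτt] at hV
    -- Since `H` fixes `σ t`, the neighbourhood can be shrunk so that all its `H`-translates lie in
    -- `V`; then the choice of point in the orbit is irrelevant.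
    have hV' : (⋂ h : H, ((h : G) • ·) ⁻¹' V) ∈ 𝓝 (σ t) := by
      refine iInter_mem.2 fun h => (continuous_const_smul (h : G)).continuousAt ?_
      rw [hfix h h.2]
      exact hV
    filter_upwards [hσ t hts _ hV'] with u ⟨h, hh, hu⟩
    obtain ⟨k, hk, hku⟩ := hτH u
    have := mem_iInter.1 hu ⟨k * h⁻¹, H.mul_mem hk (H.inv_mem hh)⟩
    simp only [mem_preimage, mul_smul, inv_smul_smul] at this
    rw [mem_preimage, hku]
    exact this

/-- Paths in the orbit space of a finite group acting on a Hausdorff space lift. -/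
theorem OrbitSpace.exists_path_lift [Finite G] [T2Space Y] (γ : C(unitInterval, OrbitSpace G Y))
    (y : Y) (hy : OrbitSpace.mk G y = γ 0) :
    ∃ P : C(unitInterval, Y), P 0 = y ∧ ∀ t, OrbitSpace.mk G (P t) = γ t := by
  let σ : ℝ → Y := fun t => (γ (projIcc 0 1 zero_le_one t)).out
  have hout : ∀ t, OrbitSpace.mk G (σ t) = γ (projIcc 0 1 zero_le_one t) := fun t =>
    Quotient.out_eq _
  have hl : Liftable (⊤ : Subgroup G) σ univ := by
    refine liftable_of_eventually _ _ isOpen_univ fun t _ V hV => ?_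
    have hop : IsOpenMap (OrbitSpace.mk G : Y → OrbitSpace G Y) :=
      isOpenMap_quotient_mk'_mul
    have h1 : OrbitSpace.mk G '' V ∈ 𝓝 (γ (projIcc 0 1 zero_le_one t)) := by
      rw [← hout]; exact hop.image_mem_nhds hV
    have h2 : Continuous fun t => γ (projIcc 0 1 zero_le_one t) :=
      γ.continuous.comp continuous_projIcc
    filter_upwards [h2.continuousAt h1] with u ⟨v, hv, hvu⟩
    replace hvu : OrbitSpace.mk G v = OrbitSpace.mk G (σ u) := hvu.trans (hout u).symm
    obtain ⟨g, hg⟩ := Quotient.exact hvu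
    exact ⟨g, Subgroup.mem_top _, by dsimp only at hg; rwa [hg]⟩
  have h0 : ∃ h ∈ (⊤ : Subgroup G), y = h • σ 0 := by
    have : OrbitSpace.mk G y = OrbitSpace.mk G (σ 0) := by
      rw [hy, hout]; simp
    obtain ⟨g, hg⟩ := Quotient.exact this
    exact ⟨g, Subgroup.mem_top _, hg.symm⟩
  obtain ⟨τ, h1, h2, h3⟩ := hl.exists_apply_eq (mem_univ 0) h0
  refine ⟨⟨fun t => τ t, (continuousOn_univ.1 h1).comp continuous_subtype_val⟩, by simpa using h3,
    fun t => ?_⟩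
  obtain ⟨g, -, hg⟩ := h2 t (mem_univ _)
  have : OrbitSpace.mk G (σ t) = γ t := by rw [hout, projIcc_val]
  rw [← this]
  exact Quotient.sound ⟨g, hg.symm⟩

end PathLifting

/-! ### The orbit map. -/

/-- The continuous orbit map. -/
def OrbitSpace.mkMap (G X : Type*) [Group G] [TopologicalSpace X] [MulAction G X] :
    C(X, OrbitSpace G X) :=
  ⟨OrbitSpace.mk G, continuous_quotient_mk'⟩

theorem OrbitSpace.mk_smul {G X : Type*} [Group G] [MulAction G X] (g : G) (y : X) :
    OrbitSpace.mk G (g • y) = OrbitSpace.mk G y :=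
  Quotient.sound ⟨g, rfl⟩

theorem OrbitSpace.mk_eq_mk {G X : Type*} [Group G] [MulAction G X] {y z : X}
    (h : OrbitSpace.mk G y = OrbitSpace.mk G z) :
    ∃ g : G, y = g • z :=
  let ⟨g, hg⟩ := Quotient.exact h
  ⟨g, hg.symm⟩

/-! ### Path classes as points of the universal cover, and the group of lifts of `G`. -/

section DeckGroup

/-- Homotopy classes of paths starting at `x`: the points of the universal cover. -/
abbrev PathClass {X : Type*} [TopologicalSpace X] (x : X) : Type _ :=
  Σ y : X, Path.Homotopic.Quotient x y

namespace PathClass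

variable {X : Type*} [TopologicalSpace X] {x : X}

/-- The class of the constant path. -/
noncomputable def base (x : X) : PathClass x := ⟨x, .refl x⟩

/-- Append a path class `d` to a path class `e` starting at `x`. -/
noncomputable def snoc (e : PathClass x) {y z : X} (d : Path.Homotopic.Quotient y z) (h : e.1 = y) :
    PathClass x :=
  ⟨z, e.2.trans (d.cast h rfl)⟩

theorem snoc_congr (e : PathClass x) {y z y' z' : X} {d : Path.Homotopic.Quotient y z}
    {d' : Path.Homotopic.Quotient y' z'} (h : e.1 = y) (h' : e.1 = y') (hz : z = z')
    (hd : d ≍ d') : e.snoc d h = e.snoc d' h' := by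
  subst h h' hz
  rw [eq_of_heq hd]

theorem snoc_refl (e : PathClass x) {y : X} (h : e.1 = y) : e.snoc (.refl y) h = e := by
  subst h
  simp [snoc]

theorem snoc_snoc (e : PathClass x) {y z w : X} (d : Path.Homotopic.Quotient y z)
    (d' : Path.Homotopic.Quotient z w) (h : e.1 = y) :
    (e.snoc d h).snoc d' rfl = e.snoc (d.trans d') h := by
  subst h
  simp [snoc]

theorem base_snoc (e : PathClass x) : (base x).snoc e.2 rfl = e := by
  simp [snoc, base]

theorem exists_eq_snoc (e a : PathClass x) :
    ∃ (z : X) (d : Path.Homotopic.Quotient e.1 z), a = e.snoc d rfl :=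
  ⟨a.1, e.2.symm.trans a.2, by simp [snoc, ← Path.Homotopic.Quotient.trans_assoc]⟩

end PathClass

variable {G X : Type*} [Group G] [TopologicalSpace X] [MulAction G X] [ContinuousConstSMul G X]

/-- The translate of a path class by a group element. -/
noncomputable def smulPath (g : G) {y z : X} (c : Path.Homotopic.Quotient y z) :
    Path.Homotopic.Quotient (g • y) (g • z) :=
  c.map ⟨(g • ·), continuous_const_smul g⟩

theorem smulPath_refl (g : G) (y : X) :
    smulPath g (Path.Homotopic.Quotient.refl y) = .refl (g • y) := rfl

theorem smulPath_trans (g : G) {y z w : X} (c : Path.Homotopic.Quotient y z)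
    (d : Path.Homotopic.Quotient z w) :
    smulPath g (c.trans d) = (smulPath g c).trans (smulPath g d) := by
  induction c using Path.Homotopic.Quotient.ind with | mk c =>
  induction d using Path.Homotopic.Quotient.ind with | mk d =>
  exact congrArg Path.Homotopic.Quotient.mk (c.map_trans d (continuous_const_smul g))

theorem one_smulPath {y z : X} (c : Path.Homotopic.Quotient y z) : smulPath (1 : G) c ≍ c := by
  induction c using Path.Homotopic.Quotient.ind with | mk c =>
  exact Path.Homotopic.hpath_hext (p₁ := c.map (continuous_const_smul (1 : G))) (p₂ := c)
    fun t => by simp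

theorem mul_smulPath (g h : G) {y z : X} (c : Path.Homotopic.Quotient y z) :
    smulPath (g * h) c ≍ smulPath g (smulPath h c) := by
  induction c using Path.Homotopic.Quotient.ind with | mk c =>
  exact Path.Homotopic.hpath_hext (p₁ := c.map (continuous_const_smul (g * h)))
    (p₂ := (c.map (continuous_const_smul h)).map (continuous_const_smul g))
    fun t => by simp [mul_smul]

/-- A permutation of the path classes starting at `x` lies over `g : G` if it acts on end points
as `g` and intertwines the appending of `d` with that of `g • d`. -/
def LiesOver {x : X} (g : G) (f : PathClass x → PathClass x) : Prop :=
  ∃ h : ∀ e, (f e).1 = g • e.1, ∀ (e : PathClass x) (z : X) (d : Path.Homotopic.Quotient e.1 z),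
    f (e.snoc d rfl) = (f e).snoc (smulPath g d) (h e)

theorem LiesOver.comp {x : X} {g h : G} {f f' : PathClass x → PathClass x} (hf : LiesOver g f)
    (hf' : LiesOver h f') : LiesOver (g * h) (f ∘ f') := by
  obtain ⟨h1, h2⟩ := hf
  obtain ⟨h1', h2'⟩ := hf'
  refine ⟨fun _ => by rw [Function.comp, h1, h1', mul_smul], fun e z d => ?_⟩
  have h3 : ∀ {y} (c : Path.Homotopic.Quotient y (h • z)) (hy : (f' e).1 = y),
      f ((f' e).snoc c hy) = (f (f' e)).snoc (smulPath g c) (by rw [h1, hy]) := by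
    intro y c hy
    subst hy
    exact h2 _ _ _
  rw [Function.comp, h2', h3]
  exact PathClass.snoc_congr _ _ _ (mul_smul _ _ _).symm (mul_smulPath g h d).symm

theorem LiesOver.apply_snoc {x : X} {g : G} {f : PathClass x → PathClass x} (hf : LiesOver g f)
    (e : PathClass x) {y z : X} (d : Path.Homotopic.Quotient y z) (h : e.1 = y) :
    f (e.snoc d h) = (f e).snoc (smulPath g d) (by rw [hf.1, h]) := by
  subst h
  exact hf.2 _ _ _

theorem LiesOver.id {x : X} : LiesOver (1 : G) (id : PathClass x → PathClass x) :=
  ⟨fun e => (one_smul G e.1).symm, fun _ z d =>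
    PathClass.snoc_congr _ _ _ (one_smul G z).symm (one_smulPath d).symm⟩

/-- Two maps lying over the same element agree if they agree at one point. -/
theorem LiesOver.eq_of_apply_eq {x : X} {g : G} {f f' : PathClass x → PathClass x}
    (hf : LiesOver g f) (hf' : LiesOver g f') {e : PathClass x} (h : f e = f' e) : f = f' := by
  funext a
  obtain ⟨z, d, rfl⟩ := e.exists_eq_snoc a
  rw [hf.apply_snoc, hf'.apply_snoc]
  simp only [h]

theorem LiesOver.inverse {x : X} {g : G} {f f' : PathClass x → PathClass x}
    (hf : LiesOver g f) (h1 : Function.LeftInverse f' f) (h2 : Function.RightInverse f' f) :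
    LiesOver g⁻¹ f' := by
  have h3 : ∀ e, (f' e).1 = g⁻¹ • e.1 := fun e => by
    rw [eq_inv_smul_iff, ← hf.1, h2]
  refine ⟨h3, fun e z d => h1.injective.eq_iff.1 ?_⟩
  rw [h2, hf.apply_snoc]
  simp only [h2 e]
  refine PathClass.snoc_congr _ _ _ (smul_inv_smul g z).symm ?_
  refine HEq.trans ?_ (mul_smulPath g g⁻¹ d)
  rw [mul_inv_cancel]
  exact (one_smulPath d).symm

/-- The map over `g` which sends `e` to `e'`. -/
noncomputable def moveMap {x : X} (g : G) (e e' : PathClass x) (h : e'.1 = g • e.1) (a : PathClass x) :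
    PathClass x :=
  e'.snoc (smulPath g (e.2.symm.trans a.2)) h

theorem moveMap_self {x : X} (g : G) (e e' : PathClass x) (h : e'.1 = g • e.1) :
    moveMap g e e' h e = e' := by
  rw [moveMap, Path.Homotopic.Quotient.symm_trans, smulPath_refl, PathClass.snoc_refl]

theorem liesOver_moveMap {x : X} (g : G) (e e' : PathClass x) (h : e'.1 = g • e.1) :
    LiesOver g (moveMap g e e' h) := by
  refine ⟨fun _ => rfl, fun a z d => ?_⟩
  have := (e'.snoc_snoc (smulPath g (e.2.symm.trans a.2)) (smulPath g d) h).symm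
  rw [← smulPath_trans] at this
  simpa [moveMap, PathClass.snoc] using this

variable (G) in
/-- The group of all lifts of elements of `G` to the universal cover. -/
def deckGroup (x : X) : Subgroup (G × Equiv.Perm (PathClass x)) where
  carrier := {γ | LiesOver γ.1 γ.2}
  one_mem' := LiesOver.id
  mul_mem' := fun {a b} ha hb => LiesOver.comp (f := a.2) (f' := b.2) ha hb
  inv_mem' := by
    intro γ h
    exact h.inverse γ.2.symm_apply_apply γ.2.apply_symm_apply

namespace deckGroup

variable {x : X}

noncomputable instance : MulAction (deckGroup G x) (PathClass x) where
  smul γ e := γ.1.2 e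
  one_smul _ := rfl
  mul_smul _ _ _ := rfl

/-- The projection of the deck group to `G`. -/
def toGroup (x : X) : deckGroup G x →* G := (MonoidHom.fst _ _).comp (deckGroup G x).subtype

theorem smul_fst (γ : deckGroup G x) (e : PathClass x) : (γ • e).1 = toGroup x γ • e.1 :=
  γ.2.1 e

theorem smul_snoc (γ : deckGroup G x) (e : PathClass x) {y z : X}
    (d : Path.Homotopic.Quotient y z) (h : e.1 = y) :
    γ • e.snoc d h = (γ • e).snoc (smulPath (toGroup x γ) d) (by rw [smul_fst, h]) :=
  LiesOver.apply_snoc γ.2 e d h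

/-- Recovers the image of `e` from that of a point reached from `e`, by walking back along the
translate of `d`. -/
theorem smul_eq_snoc_of_smul_snoc_eq {γ : deckGroup G x} {g : G} (hg : toGroup x γ = g)
    {e e' : PathClass x} {w : X}
    {d : Path.Homotopic.Quotient e.1 w} {d' : Path.Homotopic.Quotient e'.1 (g • w)}
    (h : γ • e.snoc d rfl = e'.snoc d' rfl) :
    γ • e = e'.snoc (d'.trans (smulPath g d.symm)) rfl := by
  subst hg
  have h1 : (e.snoc d rfl).snoc d.symm (y := w) rfl = e := by
    refine (PathClass.snoc_snoc _ _ _ _).trans ?_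
    rw [Path.Homotopic.Quotient.trans_symm, PathClass.snoc_refl]
  calc γ • e = γ • (e.snoc d rfl).snoc d.symm (y := w) rfl := by rw [h1]
    _ = (γ • e.snoc d rfl).snoc (smulPath (toGroup x γ) d.symm) (by rw [h]; rfl) :=
      smul_snoc _ _ _ _
    _ = (e'.snoc d' rfl).snoc (smulPath (toGroup x γ) d.symm) rfl := by simp only [h]
    _ = _ := PathClass.snoc_snoc _ _ _ _

theorem ext_of_smul_eq {γ δ : deckGroup G x} (h : toGroup x γ = toGroup x δ) {e : PathClass x}
    (he : γ • e = δ • e) : γ = δ := by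
  have h1 : LiesOver δ.1.1 γ.1.2 := by
    have := γ.2
    rwa [← show γ.1.1 = δ.1.1 from h]
  exact Subtype.ext (Prod.ext h (DFunLike.coe_injective (h1.eq_of_apply_eq δ.2 he)))

/-- The two transport maps are mutually inverse because each composite lies over `1` and fixes a
point, hence is the identity. -/
theorem exists_smul_eq (g : G) (e e' : PathClass x) (h : e'.1 = g • e.1) :
    ∃ γ : deckGroup G x, toGroup x γ = g ∧ γ • e = e' := by
  have h' : e.1 = g⁻¹ • e'.1 := by rw [h, inv_smul_smul]
  have h1 : (moveMap g⁻¹ e' e h') ∘ (moveMap g e e' h) = id :=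
    ((inv_mul_cancel g) ▸ (liesOver_moveMap g⁻¹ e' e h').comp
      (liesOver_moveMap g e e' h)).eq_of_apply_eq LiesOver.id (e := e) (by simp [moveMap_self])
  have h2 : (moveMap g e e' h) ∘ (moveMap g⁻¹ e' e h') = id :=
    ((mul_inv_cancel g) ▸ (liesOver_moveMap g e e' h).comp
      (liesOver_moveMap g⁻¹ e' e h')).eq_of_apply_eq LiesOver.id (e := e') (by simp [moveMap_self])
  exact ⟨⟨⟨g, ⟨moveMap g e e' h, moveMap g⁻¹ e' e h', fun a => congrFun h1 a,
    fun a => congrFun h2 a⟩⟩, liesOver_moveMap g e e' h⟩, rfl,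
    moveMap_self g e e' h⟩

theorem toGroup_surjective [PathConnectedSpace X] : Function.Surjective (toGroup (G := G) x) := by
  intro g
  obtain ⟨γ, hγ, -⟩ := exists_smul_eq g (PathClass.base x)
    ⟨g • x, .mk (PathConnectedSpace.somePath x (g • x))⟩ rfl
  exact ⟨γ, hγ⟩

variable (G x) in
/-- The deck transformations with a fixed point in the universal cover. -/
def elliptic : Set (deckGroup G x) := {γ | ∃ e : PathClass x, γ • e = e}

theorem conj_mem_elliptic (g : deckGroup G x) {s : deckGroup G x} (hs : s ∈ elliptic G x) :
    g * s * g⁻¹ ∈ elliptic G x := by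
  obtain ⟨e, he⟩ := hs
  exact ⟨g • e, by simp [mul_smul, he]⟩

/-- If `n` is the order of the image in `G`, then `s ^ n` lies over `1` and has a fixed point, so it
is trivial. -/
theorem isOfFinOrder_of_mem_elliptic [Finite G] {s : deckGroup G x} (hs : s ∈ elliptic G x) :
    IsOfFinOrder s := by
  obtain ⟨e, he⟩ := hs
  rw [isOfFinOrder_iff_pow_eq_one]
  refine ⟨orderOf (toGroup x s), orderOf_pos _, ext_of_smul_eq (e := e) ?_ ?_⟩
  · rw [map_pow, pow_orderOf_eq_one, map_one]
  · rw [one_smul]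
    generalize orderOf (toGroup x s) = n
    induction n with
    | zero => simp
    | succ n ih => rw [pow_succ, mul_smul, he, ih]

theorem exists_mem_elliptic [PathConnectedSpace X] {g : G} {z : X} (h : g • z = z) (x : X) :
    ∃ γ ∈ elliptic G x, toGroup x γ = g := by
  let e : PathClass x := ⟨z, .mk (PathConnectedSpace.somePath x z)⟩
  obtain ⟨γ, hγ, he⟩ := exists_smul_eq g e e h.symm
  exact ⟨γ, ⟨e, he⟩, hγ⟩

theorem exists_fixed_of_mem_elliptic {γ : deckGroup G x} (h : γ ∈ elliptic G x) :
    ∃ z : X, toGroup x γ • z = z := by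
  obtain ⟨e, he⟩ := h
  exact ⟨e.1, by rw [← smul_fst, he]⟩

end deckGroup

/-! ### Loops in the orbit space coming from paths in `X`. -/

section OrbitLoop

/-- The loop in the orbit space defined by a path between two points of an orbit. -/
noncomputable def orbitLoop {x : X} (e : PathClass x)
    (h : OrbitSpace.mk G e.1 = OrbitSpace.mk G x) :
    Path.Homotopic.Quotient (OrbitSpace.mk G x) (OrbitSpace.mk G x) :=
  (e.2.map (OrbitSpace.mkMap G X)).cast rfl h.symm

theorem map_mkMap_smulPath (g : G) {y z : X} (c : Path.Homotopic.Quotient y z) :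
    (smulPath g c).map (OrbitSpace.mkMap G X) =
      (c.map (OrbitSpace.mkMap G X)).cast (OrbitSpace.mk_smul g y) (OrbitSpace.mk_smul g z) := by
  induction c using Path.Homotopic.Quotient.ind with | mk c =>
  refine congrArg Path.Homotopic.Quotient.mk ?_
  ext t
  exact OrbitSpace.mk_smul g (c t)

theorem Path.Homotopic.Quotient.map_trans {X Y : Type*} [TopologicalSpace X] [TopologicalSpace Y]
    {y z w : X} (c : Path.Homotopic.Quotient y z) (d : Path.Homotopic.Quotient z w) (f : C(X, Y)) :
    (c.trans d).map f = (c.map f).trans (d.map f) := by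
  induction c using Path.Homotopic.Quotient.ind with | mk c =>
  induction d using Path.Homotopic.Quotient.ind with | mk d =>
  exact congrArg Path.Homotopic.Quotient.mk (c.map_trans d f.continuous)

theorem Path.Homotopic.Quotient.trans_cast {X : Type*} [TopologicalSpace X]
    {x y z z' : X} (c : Path.Homotopic.Quotient x y) (d : Path.Homotopic.Quotient x z)
    (hy : y = x) (hz' : z' = z) (hz : x = z) :
    (c.trans (d.cast hy hz')).cast rfl (hz.trans hz'.symm) =
      (c.cast rfl hy.symm).trans (d.cast rfl hz) := by
  subst hy hz' hz
  simp

/-- A path and its translate have the same image in the orbit space. This gives multiplicativity of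
the maps from deck groups to fundamental groups. -/
theorem orbitLoop_snoc_smulPath {x : X} {e : PathClass x} {g : G} (he : e.1 = g • x)
    (d : PathClass x) (hd : OrbitSpace.mk G d.1 = OrbitSpace.mk G x) :
    orbitLoop (G := G) (e.snoc (smulPath g d.2) he) ((OrbitSpace.mk_smul g d.1).trans hd) =
      (orbitLoop e (he ▸ OrbitSpace.mk_smul g x)).trans (orbitLoop d hd) := by
  obtain ⟨y, c⟩ := e
  dsimp only at he
  subst he
  simp only [orbitLoop, PathClass.snoc, Path.Homotopic.Quotient.cast_rfl_rfl,
    Path.Homotopic.Quotient.map_trans, map_mkMap_smulPath]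
  exact Path.Homotopic.Quotient.trans_cast _ _ (OrbitSpace.mk_smul g x) (OrbitSpace.mk_smul g d.1)
    hd.symm

end OrbitLoop

end DeckGroup

/-! ### The universal cover modulo elliptic elements, as a space over the orbit space. -/

section EllipticCover

/-- The path class `c` is represented by a path in `V`. -/
def StaysIn {X : Type*} [TopologicalSpace X] (V : Set X) {y z : X}
    (c : Path.Homotopic.Quotient y z) : Prop :=
  ∃ r : Path y z, .mk r = c ∧ ∀ t, r t ∈ V

namespace StaysIn

variable {X : Type*} [TopologicalSpace X] {V W : Set X} {y z w : X}
  {c : Path.Homotopic.Quotient y z} {d : Path.Homotopic.Quotient z w}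

theorem mono (h : StaysIn V c) (hVW : V ⊆ W) : StaysIn W c :=
  let ⟨r, hr, hr'⟩ := h
  ⟨r, hr, fun t => hVW (hr' t)⟩

theorem refl (h : y ∈ V) : StaysIn V (.refl y) := ⟨Path.refl y, rfl, fun _ => h⟩

theorem symm (h : StaysIn V c) : StaysIn V c.symm :=
  let ⟨r, hr, hr'⟩ := h
  ⟨r.symm, by rw [← hr]; rfl, fun t => hr' _⟩

theorem trans (h : StaysIn V c) (h' : StaysIn V d) : StaysIn V (c.trans d) := by
  obtain ⟨r, rfl, hr⟩ := h
  obtain ⟨s, rfl, hs⟩ := h'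
  refine ⟨r.trans s, rfl, fun t => ?_⟩
  rw [Path.trans_apply]
  split_ifs
  · exact hr _
  · exact hs _

theorem target_mem (h : StaysIn V c) : z ∈ V := by
  obtain ⟨r, -, hr⟩ := h
  simpa using hr 1

theorem smulPath {G : Type*} [Group G] [MulAction G X] [ContinuousConstSMul G X] (h : StaysIn V c)
    (g : G) (hg : ∀ v ∈ V, g • v ∈ W) : StaysIn W (smulPath g c) := by
  obtain ⟨r, rfl, hr⟩ := h
  exact ⟨r.map (continuous_const_smul g), rfl, fun t => hg _ (hr t)⟩

end StaysIn

variable {G X : Type*} [Group G] [TopologicalSpace X] [MulAction G X]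

variable (G) in
/-- A neighbourhood of `z` adapted to the action: path connected, invariant under the stabilizer
of `z`, disjoint from its other translates, and relatively simply connected in `X`. -/
structure IsAdaptedNhd (z : X) (V : Set X) : Prop where
  isOpen : IsOpen V
  mem : z ∈ V
  exists_staysIn : ∀ u ∈ V, ∃ c : Path.Homotopic.Quotient z u, StaysIn V c
  smul_mem : ∀ g : G, g • z = z → ∀ u ∈ V, g • u ∈ V
  smul_eq : ∀ (g : G), ∀ u ∈ V, g • u ∈ V → g • z = z
  unique : ∀ {u w : X} (c c' : Path.Homotopic.Quotient u w), StaysIn V c → StaysIn V c' → c = c'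

theorem IsAdaptedNhd.snoc_eq_self {z : X} {V : Set X} (hV : IsAdaptedNhd G z V) {x : X}
    {e : PathClass x} {y : X} {c : Path.Homotopic.Quotient e.1 y} (hc : StaysIn V c)
    (hy : y = e.1) : e.snoc c rfl = e := by
  subst hy
  rw [hV.unique c (.refl e.1) hc (.refl hc.target_mem), PathClass.snoc_refl]

variable [ContinuousConstSMul G X]

theorem SemilocallySimplyConnected.exists_isAdaptedNhd [Finite G] [T2Space X]
    [LocallyPathConnectedSpace X] (hX : SemilocallySimplyConnected X) {z : X} {U : Set X}
    (hU : U ∈ 𝓝 z) : ∃ V ⊆ U, IsAdaptedNhd G z V := by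
  obtain ⟨U₁, hU₁, hloop⟩ := hX z
  obtain ⟨W, hWo, hzW, hW⟩ := exists_isOpen_forall_smul_notMem (G := G) z
  let A := interior (U ∩ U₁) ∩ W
  have hAo : IsOpen A := isOpen_interior.inter hWo
  have hzA : z ∈ A := ⟨mem_interior_iff_mem_nhds.2 (inter_mem hU hU₁), hzW⟩
  -- Intersecting over the stabilizer gives invariance; the path component of `z` in `V₀` is then
  -- open by local path-connectedness, and still invariant.
  let V₀ : Set X := ⋂ g : MulAction.stabilizer G z, ((g : G) • ·) ⁻¹' A
  have hV₀o : IsOpen V₀ :=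
    isOpen_iInter_of_finite fun g => hAo.preimage (continuous_const_smul (g : G))
  have hzV₀ : z ∈ V₀ := mem_iInter.2 fun g => by
    have : (g : G) • z = z := g.2
    rwa [mem_preimage, this]
  have hV₀A : V₀ ⊆ A := fun v hv => by simpa using mem_iInter.1 hv 1
  have hV₀s : ∀ g : G, g • z = z → ∀ u ∈ V₀, g • u ∈ V₀ := by
    refine fun g hg u hu => mem_iInter.2 fun k => ?_
    have := mem_iInter.1 hu (k * ⟨g, hg⟩)
    simpa [mul_smul] using this
  have hVV₀ : pathComponentIn V₀ z ⊆ V₀ := pathComponentIn_subset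
  refine ⟨pathComponentIn V₀ z, fun v hv => (interior_subset (hV₀A (hVV₀ hv)).1).1,
    hV₀o.pathComponentIn z, mem_pathComponentIn_self hzV₀, ?_, ?_, ?_, ?_⟩
  · intro u hu
    obtain ⟨r, hr⟩ := (isPathConnected_pathComponentIn hzV₀).joinedIn z
      (mem_pathComponentIn_self hzV₀) u hu
    exact ⟨.mk r, r, rfl, hr⟩
  · rintro g hg u ⟨r, hr⟩
    refine ⟨(r.map (continuous_const_smul g)).cast hg.symm rfl, fun t => ?_⟩
    exact hV₀s g hg _ (hr t)
  · intro g u hu hgu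
    by_contra hne
    exact hW g hne u (hV₀A (hVV₀ hu)).2 (hV₀A (hVV₀ hgu)).2
  · rintro u w _ _ ⟨r, rfl, hr⟩ ⟨r', rfl, hr'⟩
    obtain ⟨a, ha⟩ : JoinedIn V₀ z u := by
      have := hr 0
      rwa [r.source] at this
    -- Parallel paths in `V`, joined to `z` inside `V₀`, form a loop at `z` in `U₁`, hence
    -- null-homotopic.
    have key := hloop ((a.trans r).trans (a.trans r').symm) (by
      have h : ∀ v ∈ V₀, v ∈ U₁ := fun v hv => (interior_subset (hV₀A hv).1).2
      rw [Path.trans_range, Path.symm_range, Path.trans_range, Path.trans_range]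
      refine union_subset (union_subset ?_ ?_) (union_subset ?_ ?_) <;> rintro _ ⟨t, rfl⟩
      · exact h _ (ha t)
      · exact h _ (hVV₀ (hr t))
      · exact h _ (ha t)
      · exact h _ (hVV₀ (hr' t)))
    have key' := Path.Homotopic.Quotient.eq.2 key
    simp only [Path.Homotopic.Quotient.mk_trans, Path.Homotopic.Quotient.mk_symm,
      Path.Homotopic.Quotient.mk_refl] at key'
    set A := Path.Homotopic.Quotient.mk a
    set R := Path.Homotopic.Quotient.mk r
    set R' := Path.Homotopic.Quotient.mk r'
    have h1 : A.trans R = A.trans R' := by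
      calc A.trans R = ((A.trans R).trans (A.trans R').symm).trans (A.trans R') := by
            rw [Path.Homotopic.Quotient.trans_assoc (A.trans R)]; simp
        _ = A.trans R' := by rw [key']; simp
    calc R = A.symm.trans (A.trans R) := by
          rw [← Path.Homotopic.Quotient.trans_assoc]; simp
      _ = R' := by rw [h1, ← Path.Homotopic.Quotient.trans_assoc]; simp

variable (G) in
/-- The quotient of the universal cover by the group generated by the deck transformations with
fixed points. -/
def EllipticCover (x : X) : Type _ :=
  MulAction.orbitRel.Quotient (Subgroup.closure (deckGroup.elliptic G x)) (PathClass x)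

namespace EllipticCover

variable {x : X}

variable (G) in
/-- The point of the cover defined by a path class. -/
noncomputable def mk (e : PathClass x) : EllipticCover G x := Quotient.mk _ e

theorem mk_surjective : Function.Surjective (mk G : PathClass x → EllipticCover G x) :=
  Quotient.mk_surjective

theorem mk_eq_mk {e e' : PathClass x} : mk G e = mk G e' ↔
    ∃ n ∈ Subgroup.closure (deckGroup.elliptic G x), n • e' = e := by
  refine Quotient.eq.trans ?_
  constructor
  · rintro ⟨n, hn⟩
    exact ⟨n, n.2, hn⟩
  · rintro ⟨n, hn, h⟩
    exact ⟨⟨n, hn⟩, h⟩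

/-- Small paths starting at the end of `e` lead to points of `O`. -/
def IsNhd (O : Set (EllipticCover G x)) (e : PathClass x) : Prop :=
  ∃ V ∈ 𝓝 e.1, ∀ (z : X) (d : Path.Homotopic.Quotient e.1 z), StaysIn V d →
    mk G (e.snoc d rfl) ∈ O

/-- Deck transformations carry small paths to small paths, so openness can be tested at one
representative of each class. -/
theorem IsNhd.smul {O : Set (EllipticCover G x)} {e : PathClass x} (h : IsNhd O e)
    {n : deckGroup G x} (hn : n ∈ Subgroup.closure (deckGroup.elliptic G x)) :
    IsNhd O (n • e) := by
  obtain ⟨V, hV, hVO⟩ := h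
  set g := deckGroup.toGroup x n with hg
  refine ⟨(g⁻¹ • ·) ⁻¹' V, ?_, fun z d hd => ?_⟩
  · refine (continuous_const_smul g⁻¹).continuousAt ?_
    rwa [deckGroup.smul_fst, inv_smul_smul]
  · have h1 := deckGroup.smul_snoc n⁻¹ (n • e) d rfl
    simp only [inv_smul_smul] at h1
    have h2 : mk G ((n • e).snoc d rfl) = mk G (n⁻¹ • (n • e).snoc d rfl) :=
      mk_eq_mk.2 ⟨n, hn, smul_inv_smul _ _⟩
    rw [h2, h1]
    have h3 : ∀ {y} (c : Path.Homotopic.Quotient y (g⁻¹ • z)) (hy : e.1 = y),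
        StaysIn V c → mk G (e.snoc c hy) ∈ O := by
      intro y c hy hc
      subst hy
      exact hVO _ _ hc
    refine h3 _ _ (hd.smulPath _ fun v hv => ?_)
    simpa [hg] using hv

/-- The quotient of the usual topology of the universal cover, expressed directly by small paths. -/
instance : TopologicalSpace (EllipticCover G x) where
  IsOpen O := ∀ e, mk G e ∈ O → IsNhd O e
  isOpen_univ := fun _ _ => ⟨univ, univ_mem, fun _ _ _ => mem_univ _⟩
  isOpen_inter := by
    intro O O' h h' e he
    obtain ⟨V, hV, hVO⟩ := h e he.1
    obtain ⟨V', hV', hVO'⟩ := h' e he.2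
    exact ⟨V ∩ V', inter_mem hV hV', fun z d hd =>
      ⟨hVO z d (hd.mono inter_subset_left), hVO' z d (hd.mono inter_subset_right)⟩⟩
  isOpen_sUnion := by
    rintro S h e ⟨O, hO, he⟩
    obtain ⟨V, hV, hVO⟩ := h O hO e he
    exact ⟨V, hV, fun z d hd => ⟨O, hO, hVO z d hd⟩⟩

/-- The covering projection to the orbit space. -/
noncomputable def proj : EllipticCover G x → OrbitSpace G X :=
  Quotient.lift (fun e : PathClass x => OrbitSpace.mk G e.1) (by
    rintro e e' ⟨n, rfl⟩
    exact (congrArg (OrbitSpace.mk G) (deckGroup.smul_fst n.1 e')).trans (OrbitSpace.mk_smul _ _))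

/-- The points reached from `e` by paths in `V`. -/
def sheet (e : PathClass x) (V : Set X) : Set (EllipticCover G x) :=
  {ε | ∃ (z : X) (d : Path.Homotopic.Quotient e.1 z), StaysIn V d ∧ mk G (e.snoc d rfl) = ε}

theorem isOpen_sheet (e : PathClass x) {V : Set X} (hV : IsOpen V) :
    IsOpen (sheet (G := G) e V) := by
  rintro e' ⟨z, d, hd, h⟩
  obtain ⟨n, hn, h⟩ := mk_eq_mk.1 h.symm
  subst h
  refine IsNhd.smul ⟨V, hV.mem_nhds hd.target_mem, fun w d' hd' => ?_⟩ hn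
  exact ⟨w, _, hd.trans hd', congrArg (mk G) (PathClass.snoc_snoc _ _ _ _).symm⟩

theorem mem_sheet (e : PathClass x) {V : Set X} (hV : e.1 ∈ V) : mk G e ∈ sheet (G := G) e V :=
  ⟨e.1, .refl _, .refl hV, by rw [PathClass.snoc_refl]⟩

/-- If `g` identifies the ends of two short paths from `e`, then `g` fixes the end point of `e`, and
the lift of `g` matching the two paths fixes `e`. It is thus elliptic and already divided out. -/
theorem injOn_proj_sheet {e : PathClass x} {V : Set X} (hV : IsAdaptedNhd G e.1 V) :
    InjOn proj (sheet (G := G) e V) := by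
  rintro _ ⟨w', d', hd', rfl⟩ _ ⟨w, d, hd, rfl⟩ h
  obtain ⟨g, hg⟩ := OrbitSpace.mk_eq_mk (G := G) (show OrbitSpace.mk G w' = OrbitSpace.mk G w from h)
  subst hg
  have hgz : g • e.1 = e.1 := hV.smul_eq g w hd.target_mem hd'.target_mem
  obtain ⟨γ, hγg, hγ⟩ := deckGroup.exists_smul_eq g (e.snoc d rfl) (e.snoc d' rfl) rfl
  refine mk_eq_mk.2 ⟨γ, Subgroup.subset_closure ⟨e, ?_⟩, hγ⟩
  rw [deckGroup.smul_eq_snoc_of_smul_snoc_eq hγg hγ]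
  exact hV.snoc_eq_self (hd'.trans (hd.symm.smulPath g (hV.smul_mem g hgz))) hgz

theorem continuous_proj : Continuous (proj : EllipticCover G x → OrbitSpace G X) := by
  refine ⟨fun U hU e he => ⟨OrbitSpace.mk G ⁻¹' U, ?_, fun z d hd => hd.target_mem⟩⟩
  exact (hU.preimage continuous_quotient_mk').mem_nhds he

variable [Finite G] [T2Space X] [LocallyPathConnectedSpace X]

theorem isOpenMap_proj (hX : SemilocallySimplyConnected X) :
    IsOpenMap (proj : EllipticCover G x → OrbitSpace G X) := by
  refine fun O hO => isOpen_iff_mem_nhds.2 ?_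
  rintro _ ⟨ε, hε, rfl⟩
  obtain ⟨e, rfl⟩ := mk_surjective ε
  obtain ⟨V, hV, hVO⟩ := hO e hε
  obtain ⟨W, hWV, hW⟩ := hX.exists_isAdaptedNhd (G := G) hV
  have hop : IsOpenMap (OrbitSpace.mk G : X → OrbitSpace G X) := isOpenMap_quotient_mk'_mul
  refine mem_of_superset (hop.image_mem_nhds (hW.isOpen.mem_nhds hW.mem)) ?_
  rintro _ ⟨u, hu, rfl⟩
  obtain ⟨c, hc⟩ := hW.exists_staysIn u hu
  exact ⟨_, hVO u c (hc.mono hWV), rfl⟩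

theorem isLocalHomeomorph_proj (hX : SemilocallySimplyConnected X) :
    IsLocalHomeomorph (proj : EllipticCover G x → OrbitSpace G X) := by
  refine isLocalHomeomorph_iff_isOpenEmbedding_restrict.2 fun ε => ?_
  obtain ⟨e, rfl⟩ := mk_surjective ε
  obtain ⟨V, -, hV⟩ := hX.exists_isAdaptedNhd (G := G) (univ_mem (f := 𝓝 e.1))
  have ho := isOpen_sheet (G := G) e hV.isOpen
  exact ⟨sheet e V, ho.mem_nhds (mem_sheet e hV.mem),
    .of_continuous_injective_isOpenMap (continuous_proj.comp continuous_subtype_val)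
      (injOn_iff_injective.1 (injOn_proj_sheet hV)) ((isOpenMap_proj hX).domRestrict ho)⟩

/-- Take sheets over `V` and `g V`, with `g V` inside an adapted neighbourhood of the other end
point. If they met, an element `n` of the elliptic subgroup would move `e` to `e'` followed by a
loop in that neighbourhood; the loop is trivial, so the two points would coincide. -/
theorem isSeparatedMap_proj (hX : SemilocallySimplyConnected X) :
    IsSeparatedMap (proj : EllipticCover G x → OrbitSpace G X) := by
  intro ε ε' h hne
  obtain ⟨e, rfl⟩ := mk_surjective ε
  obtain ⟨e', rfl⟩ := mk_surjective ε'
  obtain ⟨g, hg⟩ := OrbitSpace.mk_eq_mk (G := G)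
    (show OrbitSpace.mk G e'.1 = OrbitSpace.mk G e.1 from h.symm)
  obtain ⟨V', -, hV'⟩ := hX.exists_isAdaptedNhd (G := G) (univ_mem (f := 𝓝 e'.1))
  obtain ⟨V, hVV', hV⟩ := hX.exists_isAdaptedNhd (G := G) (z := e.1) (U := (g • ·) ⁻¹' V')
    ((hV'.isOpen.preimage (continuous_const_smul g)).mem_nhds (by simpa [← hg] using hV'.mem))
  have hgV : IsOpen ((g⁻¹ • ·) ⁻¹' V) := hV.isOpen.preimage (continuous_const_smul g⁻¹)
  refine ⟨sheet e V, sheet e' ((g⁻¹ • ·) ⁻¹' V), isOpen_sheet _ hV.isOpen, isOpen_sheet _ hgV,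
    mem_sheet _ hV.mem, mem_sheet _ (by simpa [hg] using hV.mem), disjoint_left.2 ?_⟩
  rintro _ ⟨w, d, hd, rfl⟩ ⟨w', d', hd', heq⟩
  obtain ⟨n, hn, hne'⟩ := mk_eq_mk.1 heq
  refine hne (mk_eq_mk.2 ⟨n, hn, ?_⟩).symm
  set k := deckGroup.toGroup x n with hk
  have hw : w' = k • w := by
    have := deckGroup.smul_fst n (e.snoc d rfl)
    rwa [hne'] at this
  subst hw
  have hkz : (g⁻¹ * k) • e.1 = e.1 := by
    refine hV.smul_eq _ w hd.target_mem ?_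
    rw [mul_smul]
    exact hd'.target_mem
  rw [deckGroup.smul_eq_snoc_of_smul_snoc_eq hk.symm hne']
  have h3 : StaysIn ((g⁻¹ • ·) ⁻¹' V) (smulPath k d.symm) := by
    refine hd.symm.smulPath k fun v hv => ?_
    rw [mem_preimage, ← mul_smul]
    exact hV.smul_mem _ hkz v hv
  refine hV'.snoc_eq_self ((hd'.trans h3).mono fun v hv => ?_) ?_
  · simpa using hVV' hv
  · rw [hg, ← inv_smul_eq_iff, ← mul_smul, hkz]

end EllipticCover

end EllipticCover

/-! ### The monodromy argument bounding the kernel. -/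

section Kernel

variable {G X : Type*} [Group G] [TopologicalSpace X] [MulAction G X]

/-- The class of the restriction of a path to `[0, t]`. -/
noncomputable def Path.initialClass {x y : X} (P : Path x y) (t : unitInterval) : PathClass x :=
  ⟨P t, (Path.Homotopic.Quotient.mk (P.subpath 0 t)).cast P.source.symm rfl⟩

theorem Path.initialClass_zero {x y : X} (P : Path x y) :
    P.initialClass 0 = PathClass.base x := by
  refine Sigma.ext P.source ?_
  change (Path.Homotopic.Quotient.mk (P.subpath 0 0)).cast P.source.symm rfl ≍ _
  refine (Path.Homotopic.Quotient.cast_heq P.source.symm rfl).trans ?_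
  exact Path.Homotopic.hpath_hext (p₁ := P.subpath 0 0) (p₂ := Path.refl x) fun t => by simp

theorem Path.initialClass_one {x y : X} (P : Path x y) :
    P.initialClass 1 = ⟨y, .mk P⟩ := by
  refine Sigma.ext P.target ?_
  change (Path.Homotopic.Quotient.mk (P.subpath 0 1)).cast P.source.symm rfl ≍ _
  refine (Path.Homotopic.Quotient.cast_heq P.source.symm rfl).trans ?_
  exact Path.Homotopic.hpath_hext (p₁ := P.subpath 0 1) (p₂ := P) fun t => by simp

theorem Path.initialClass_snoc {x y : X} (P : Path x y) (s t : unitInterval) :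
    (P.initialClass s).snoc (.mk (P.subpath s t)) rfl = P.initialClass t := by
  refine Sigma.ext rfl (heq_of_eq ?_)
  have h := Path.Homotopic.Quotient.eq.2 ⟨Path.Homotopy.subpathTransSubpath P 0 s t⟩
  rw [Path.Homotopic.Quotient.mk_trans] at h
  simp only [initialClass, PathClass.snoc, ← h, Path.Homotopic.Quotient.cast_rfl_rfl]
  generalize Path.Homotopic.Quotient.mk (P.subpath 0 s) = c
  generalize Path.Homotopic.Quotient.mk (P.subpath s t) = d
  have key : ∀ {a b u v : X} (hb : a = b) (c : Path.Homotopic.Quotient b u)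
      (d : Path.Homotopic.Quotient u v),
      (c.cast hb rfl).trans d = (c.trans d).cast hb rfl := by
    intro a b u v hb c d
    subst hb
    simp
  exact key _ _ _

variable [ContinuousConstSMul G X]

variable (G) in
theorem EllipticCover.continuous_mk_initialClass {x y : X} (P : Path x y) :
    Continuous fun t => EllipticCover.mk G (P.initialClass t) := by
  refine ⟨fun O hO => isOpen_iff_mem_nhds.2 fun s hs => ?_⟩
  obtain ⟨V, hV, hVO⟩ := hO _ hs
  have hP : P ⁻¹' V ∈ 𝓝 s := P.continuous.continuousAt hV
  -- On this component the whole piece of the path between the times `s` and `t` stays in `V`.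
  filter_upwards [ordConnectedComponent_mem_nhds.2 hP] with t ht
  rw [mem_preimage, ← P.initialClass_snoc s t]
  refine hVO _ _ ⟨_, rfl, fun r => ?_⟩
  have h1 : P '' uIcc s t ⊆ V := image_subset_iff.2 ht
  rw [← Path.range_subpath] at h1
  exact h1 (mem_range_self r)

/-- A deck transformation whose associated loop in the orbit space is null-homotopic is a product
of deck transformations with fixed points. -/
theorem deckGroup.mem_closure_elliptic [Finite G] [T2Space X] [LocallyPathConnectedSpace X]
    (hX : SemilocallySimplyConnected X) {x : X} (γ : deckGroup G x)
    (h : OrbitSpace.mk G (γ • PathClass.base x).1 = OrbitSpace.mk G x)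
    (hγ : orbitLoop (γ • PathClass.base x) h = .refl _) :
    γ ∈ Subgroup.closure (deckGroup.elliptic G x) := by
  obtain ⟨y, c, hyc⟩ : ∃ y c, γ • PathClass.base x = ⟨y, c⟩ := ⟨_, _, rfl⟩
  -- If `γ` and some `n` in the elliptic subgroup move the base point alike, then `n⁻¹ * γ` fixes it
  -- and is elliptic.
  suffices hmk : EllipticCover.mk G (γ • PathClass.base x) =
      EllipticCover.mk G (PathClass.base x) by
    obtain ⟨n, hn, hn'⟩ := EllipticCover.mk_eq_mk.1 hmk
    have h1 : n⁻¹ * γ ∈ Subgroup.closure (deckGroup.elliptic G x) :=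
      Subgroup.subset_closure ⟨PathClass.base x, by rw [mul_smul, ← hn', inv_smul_smul]⟩
    have := mul_mem hn h1
    rwa [mul_inv_cancel_left] at this
  simp only [hyc] at h hγ ⊢
  induction c using Path.Homotopic.Quotient.ind with | mk P =>
  obtain ⟨H⟩ := Path.Homotopic.Quotient.exact
    (show Path.Homotopic.Quotient.mk ((P.map (OrbitSpace.mkMap G X).continuous).cast rfl h.symm) =
      .mk (Path.refl (OrbitSpace.mk G x)) from hγ)
  -- Each path of the null-homotopy is lifted to `X` separately, with `P` and the constant path
  -- prescribed at the two ends. No continuity in `s` is needed: after passage to the elliptic cover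
  -- the monodromy theorem shows that the end points agree.
  have hlift : ∀ s : unitInterval, ∃ (z : X) (Q : Path x z),
      (∀ t, OrbitSpace.mk G (Q t) = H (s, t)) ∧
      (s = 0 → Q.initialClass 1 = P.initialClass 1) ∧
      (s = 1 → Q.initialClass 1 = PathClass.base x) := by
    intro s
    by_cases h0 : s = 0
    · subst h0
      exact ⟨y, P, fun t => (H.apply_zero t).symm, fun _ => rfl, fun h => absurd h zero_ne_one⟩
    by_cases h1 : s = 1
    · subst h1
      refine ⟨x, Path.refl x, fun t => (H.apply_one t).symm, fun h => absurd h one_ne_zero,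
        fun _ => ?_⟩
      rw [Path.initialClass_one]
      rfl
    · obtain ⟨Q, hQ0, hQ⟩ := OrbitSpace.exists_path_lift (G := G)
        (H.toContinuousMap.comp ⟨fun t => (s, t), by fun_prop⟩) x (H.source s).symm
      exact ⟨Q 1, ⟨Q, hQ0, rfl⟩, hQ, fun h => absurd h h0, fun h => absurd h h1⟩
  choose z Q hQ hQ0 hQ1 using hlift
  have hm := (EllipticCover.isLocalHomeomorph_proj (G := G) (x := x) hX).monodromy_theorem
    (EllipticCover.isSeparatedMap_proj hX) H
    (fun s => ⟨_, EllipticCover.continuous_mk_initialClass G (Q s)⟩)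
    (fun s t => hQ s t)
    (fun s => congrArg (EllipticCover.mk G)
      ((Q s).initialClass_zero.trans (Q 0).initialClass_zero.symm)) 1
  have hm' : EllipticCover.mk G ((Q 1).initialClass 1) =
      EllipticCover.mk G ((Q 0).initialClass 1) := hm
  rw [hQ0 0 rfl, hQ1 1 rfl, Path.initialClass_one] at hm'
  exact hm'.symm

end Kernel

/-! ### Calculus of path classes. -/

theorem Path.Homotopic.Quotient.symm_symm {X : Type*} [TopologicalSpace X] {x y : X}
    (c : Path.Homotopic.Quotient x y) : c.symm.symm = c := by
  induction c using Path.Homotopic.Quotient.ind with | mk r =>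
  exact congrArg Path.Homotopic.Quotient.mk r.symm_symm

theorem Path.Homotopic.Quotient.trans_symm_rev {X : Type*} [TopologicalSpace X] {x y z : X}
    (c : Path.Homotopic.Quotient x y) (d : Path.Homotopic.Quotient y z) :
    (c.trans d).symm = d.symm.trans c.symm := by
  induction c using Path.Homotopic.Quotient.ind with | mk r =>
  induction d using Path.Homotopic.Quotient.ind with | mk s =>
  exact congrArg Path.Homotopic.Quotient.mk (Path.trans_symm r s)

theorem Path.Homotopic.Quotient.map_symm {X Y : Type*} [TopologicalSpace X] [TopologicalSpace Y]
    {x y : X} (c : Path.Homotopic.Quotient x y) (f : C(X, Y)) : c.symm.map f = (c.map f).symm := by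
  induction c using Path.Homotopic.Quotient.ind with | mk r => rfl

theorem Path.Homotopic.Quotient.trans_cast_heq {X : Type*} [TopologicalSpace X]
    {x y z z' : X} (c : Path.Homotopic.Quotient x y) (d : Path.Homotopic.Quotient x z)
    (hy : y = x) (hz' : z' = z) :
    c.trans (d.cast hy hz') ≍ (c.cast rfl hy.symm).trans d := by
  subst hy hz'
  simp

theorem Path.Homotopic.Quotient.refl_eq_of_eq_trans {X : Type*} [TopologicalSpace X] {x y : X}
    {l : Path.Homotopic.Quotient x x} {b : Path.Homotopic.Quotient x y} (h : b = l.trans b) :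
    .refl x = l := by
  have h' := congrArg (fun c => c.trans b.symm) h
  simpa only [trans_assoc, trans_symm, trans_refl] using h'

/-! ### Comparison of deck groups and their fibre product with fundamental groups. -/

section Comparison

variable {G X : Type*} [Group G] [TopologicalSpace X] [MulAction G X]

theorem map_proj_orbitLoop {ι : Type*} {x : ι → X} (i : ι) (e : PathClass x)
    (h : OrbitSpace.mk G e.1 = OrbitSpace.mk G x)
    (h' : OrbitSpace.mk G (e.1 i) = OrbitSpace.mk G (x i)) :
    (orbitLoop e h).map (OrbitSpace.proj G X i) =
      orbitLoop (x := x i) ⟨e.1 i, Path.Homotopic.proj i e.2⟩ h' := by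
  obtain ⟨y, c⟩ := e
  induction c using Path.Homotopic.Quotient.ind with | mk r => rfl

theorem orbitLoop_congr {x : X} {e e' : PathClass x} (he : e = e')
    (h : OrbitSpace.mk G e.1 = OrbitSpace.mk G x) :
    orbitLoop e h = orbitLoop e' (he ▸ h) := by
  subst he
  rfl

theorem smulPath_pi [ContinuousConstSMul G X] {ι : Type*} (g : G) {y z : ι → X}
    (c : ∀ i, Path.Homotopic.Quotient (y i) (z i)) :
    smulPath g (Path.Homotopic.pi c) = Path.Homotopic.pi fun i => smulPath g (c i) := by
  choose r hr using fun i => Path.Homotopic.Quotient.mk_surjective (c i)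
  obtain rfl : c = fun i => .mk (r i) := funext fun i => (hr i).symm
  exact (congrArg (smulPath g) (Path.Homotopic.pi_lift r)).trans
    (Path.Homotopic.pi_lift fun i => (r i).map (continuous_const_smul g)).symm

/-- The path class in a power determined by path classes in the factors. -/
noncomputable def PathClass.pi {ι : Type*} {x : ι → X} (e : ∀ i, PathClass (x i)) : PathClass x :=
  ⟨fun i => (e i).1, Path.Homotopic.pi fun i => (e i).2⟩

theorem PathClass.pi_snoc {ι : Type*} {x y z : ι → X} (e : ∀ i, PathClass (x i))
    (d : ∀ i, Path.Homotopic.Quotient (y i) (z i)) (h : ∀ i, (e i).1 = y i) :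
    PathClass.pi (fun i => (e i).snoc (d i) (h i)) =
      (PathClass.pi e).snoc (Path.Homotopic.pi d) (funext h) := by
  obtain rfl : (fun i => (e i).1) = y := funext h
  simp only [PathClass.pi, PathClass.snoc, Path.Homotopic.Quotient.cast_rfl_rfl,
    Path.Homotopic.comp_pi_eq_pi_comp]

variable [ContinuousConstSMul G X]

/-- If `e · g a = a` as path classes then the loop defined by `e` is null-homotopic. -/
theorem eq_orbitLoop_trans {x : X} {e : PathClass x} {g : G} (he : e.1 = g • x) {a : PathClass x}
    (ha : a = e.snoc (smulPath g a.2) he) :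
    Path.Homotopic.Quotient.refl _ = orbitLoop (G := G) e (he ▸ OrbitSpace.mk_smul (G := G) g x) := by
  -- Pushed to the orbit space, the equation for `a` reads `a = l · a` with `l` the loop of `e`;
  -- cancelling `a` gives triviality.
  let push : PathClass x → PathClass (OrbitSpace.mk G x) := fun b =>
    ⟨OrbitSpace.mk G b.1, b.2.map (OrbitSpace.mkMap G X)⟩
  have key : push (e.snoc (smulPath g a.2) he) =
      ⟨OrbitSpace.mk G a.1, (orbitLoop (G := G) e (he ▸ OrbitSpace.mk_smul (G := G) g x)).trans
        (a.2.map (OrbitSpace.mkMap G X))⟩ := by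
    clear ha
    obtain ⟨y, c⟩ := e
    dsimp only at he
    subst he
    refine Sigma.ext (OrbitSpace.mk_smul g a.1) ?_
    simp only [push, orbitLoop, PathClass.snoc, Path.Homotopic.Quotient.cast_rfl_rfl,
      Path.Homotopic.Quotient.map_trans, map_mkMap_smulPath]
    exact Path.Homotopic.Quotient.trans_cast_heq _ _ (OrbitSpace.mk_smul g x)
      (OrbitSpace.mk_smul g a.1)
  rw [← ha] at key
  have h : a.2.map (OrbitSpace.mkMap G X) =
      (orbitLoop (G := G) e (he ▸ OrbitSpace.mk_smul (G := G) g x)).trans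
        (a.2.map (OrbitSpace.mkMap G X)) := eq_of_heq (Sigma.mk.inj key).2
  exact Path.Homotopic.Quotient.refl_eq_of_eq_trans h

theorem exists_orbitLoop_eq [Finite G] [T2Space X] {x : X}
    (c : Path.Homotopic.Quotient (OrbitSpace.mk G x) (OrbitSpace.mk G x)) :
    ∃ (g : G) (e : PathClass x) (h : e.1 = g • x),
      orbitLoop e (h ▸ OrbitSpace.mk_smul g x) = c := by
  induction c using Path.Homotopic.Quotient.ind with | mk r =>
  obtain ⟨Q, hQ0, hQ⟩ := OrbitSpace.exists_path_lift (G := G) r.toContinuousMap x r.source.symm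
  obtain ⟨g, hg⟩ := OrbitSpace.mk_eq_mk (G := G) ((hQ 1).trans r.target)
  refine ⟨g, ⟨Q 1, .mk ⟨Q, hQ0, rfl⟩⟩, hg, congrArg Path.Homotopic.Quotient.mk ?_⟩
  ext t
  exact hQ t

theorem mk_smul_base {x : X} (γ : deckGroup G x) :
    OrbitSpace.mk G (γ • PathClass.base x).1 = OrbitSpace.mk G x := by
  rw [deckGroup.smul_fst]
  exact OrbitSpace.mk_smul _ _

theorem mul_smul_base {x : X} (γ δ : deckGroup G x) :
    (γ * δ) • PathClass.base x = (γ • PathClass.base x).snoc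
      (smulPath (deckGroup.toGroup x γ) (δ • PathClass.base x).2) (deckGroup.smul_fst _ _) := by
  rw [mul_smul]
  conv_lhs => rw [← PathClass.base_snoc (δ • PathClass.base x)]
  exact deckGroup.smul_snoc _ _ _ _

variable (G) in
/-- The homomorphism from the deck group to the fundamental group of the orbit space. -/
noncomputable def deckGroup.toFundamentalGroup (x : X) :
    deckGroup G x →* FundamentalGroup (OrbitSpace G X) (OrbitSpace.mk G x) :=
  -- Products in `FundamentalGroup` concatenate in the reverse order, so the inverse loop is what
  -- makes the map a homomorphism.
  MonoidHom.mk' (fun γ => (orbitLoop (γ • PathClass.base x) (mk_smul_base γ)).symm)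
    fun γ δ => by
      rw [orbitLoop_congr (mul_smul_base γ δ), FundamentalGroup.mul_def,
        ← Path.Homotopic.Quotient.trans_symm_rev]
      exact congrArg _ (orbitLoop_snoc_smulPath (deckGroup.smul_fst _ _) _ (mk_smul_base δ))

theorem deckGroup.toFundamentalGroup_surjective [Finite G] [T2Space X] (x : X) :
    Function.Surjective (toFundamentalGroup G x) := by
  intro c
  obtain ⟨g, e, he, hc⟩ := exists_orbitLoop_eq (G := G) (Path.Homotopic.Quotient.symm c)
  obtain ⟨γ, -, hγ⟩ := exists_smul_eq g (PathClass.base x) e he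
  refine ⟨γ, ?_⟩
  have h : (orbitLoop (γ • PathClass.base x) (mk_smul_base γ)).symm = c := by
    rw [orbitLoop_congr hγ, hc, Path.Homotopic.Quotient.symm_symm]
  exact h

theorem deckGroup.ker_toFundamentalGroup_le [Finite G] [T2Space X] [LocallyPathConnectedSpace X]
    (hX : SemilocallySimplyConnected X) (x : X) :
    (toFundamentalGroup G x).ker ≤ Subgroup.closure (elliptic G x) := by
  intro γ hγ
  refine mem_closure_elliptic hX γ (mk_smul_base γ) ?_
  have h : (orbitLoop (γ • PathClass.base x) (mk_smul_base γ)).symm = .refl _ := hγ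
  rw [← Path.Homotopic.Quotient.symm_symm (orbitLoop _ _), h]
  rfl

/-- A path class in a power obtained by moving the base point by compatible deck transformations. -/
noncomputable def tuplePath {ι : Type*} (x : ι → X) (γ : ∀ i, deckGroup G (x i)) : PathClass x :=
  PathClass.pi fun i => γ i • PathClass.base (x i)

theorem tuplePath_fst {ι : Type*} {x : ι → X} {γ : ∀ i, deckGroup G (x i)} {g : G}
    (h : ∀ i, deckGroup.toGroup (x i) (γ i) = g) : (tuplePath x γ).1 = g • x :=
  funext fun i => (deckGroup.smul_fst _ _).trans (by rw [h i]; rfl)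

theorem mk_tuplePath {ι : Type*} {x : ι → X}
    (γ : fibreProduct fun i => deckGroup.toGroup (G := G) (x i)) :
    OrbitSpace.mk G (tuplePath x γ.1).1 = OrbitSpace.mk G x := by
  obtain ⟨g, hg⟩ := γ.2
  rw [tuplePath_fst hg, OrbitSpace.mk_smul]

theorem pi_smul {ι : Type*} {x : ι → X} {γ : ∀ i, deckGroup G (x i)} {g : G}
    (h : ∀ i, deckGroup.toGroup (x i) (γ i) = g) (e : ∀ i, PathClass (x i)) :
    PathClass.pi (fun i => γ i • e i) =
      (tuplePath x γ).snoc (smulPath g (PathClass.pi e).2) (tuplePath_fst h) := by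
  have h1 : ∀ i, γ i • e i = (γ i • PathClass.base (x i)).snoc (smulPath g (e i).2)
      (by rw [deckGroup.smul_fst, h]; rfl) := by
    intro i
    obtain rfl := h i
    conv_lhs => rw [← PathClass.base_snoc (e i)]
    exact deckGroup.smul_snoc _ _ _ _
  simp only [h1]
  refine (PathClass.pi_snoc _ _ _).trans ?_
  exact congrArg (fun d => (tuplePath x γ).snoc d (tuplePath_fst h))
    (smulPath_pi g fun i => (e i).2).symm

/-- The homomorphism from the fibre product of the deck groups to the fundamental group of the
orbit space of the diagonal action. -/
noncomputable def tupleHom {ι : Type*} (x : ι → X) :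
    (fibreProduct fun i => deckGroup.toGroup (G := G) (x i)) →*
      FundamentalGroup (OrbitSpace G (ι → X)) (OrbitSpace.mk G x) :=
  MonoidHom.mk' (fun γ => (orbitLoop (tuplePath x γ.1) (mk_tuplePath γ)).symm)
    fun γ δ => by
      obtain ⟨g, hg⟩ := γ.2
      have h : tuplePath x (γ * δ).1 =
          (tuplePath x γ.1).snoc (smulPath g (tuplePath x δ.1).2) (tuplePath_fst hg) :=
        (congrArg PathClass.pi (funext fun i => mul_smul (γ.1 i) (δ.1 i) _)).trans (pi_smul hg _)
      rw [orbitLoop_congr h, FundamentalGroup.mul_def, ← Path.Homotopic.Quotient.trans_symm_rev]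
      exact congrArg _ (orbitLoop_snoc_smulPath (tuplePath_fst hg) _ (mk_tuplePath δ))

theorem tupleHom_surjective [Finite G] [T2Space X] {ι : Type*} (x : ι → X) :
    Function.Surjective (tupleHom (G := G) x) := by
  intro c
  obtain ⟨g, e, he, hc⟩ := exists_orbitLoop_eq (G := G) (Path.Homotopic.Quotient.symm c)
  choose γ hγg hγ using fun i => deckGroup.exists_smul_eq g (PathClass.base (x i))
    ⟨e.1 i, Path.Homotopic.proj i e.2⟩ (congrFun he i)
  have h1 : tuplePath x γ = e := by
    rw [tuplePath]
    simp only [hγ]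
    exact Sigma.ext rfl (heq_of_eq (Path.Homotopic.pi_proj e.2))
  refine ⟨⟨γ, g, hγg⟩, ?_⟩
  have h : (orbitLoop (tuplePath x γ) (mk_tuplePath ⟨γ, g, hγg⟩)).symm = c := by
    rw [orbitLoop_congr h1, hc, Path.Homotopic.Quotient.symm_symm]
  exact h

/-- Fixed points of the coordinates assemble to a path class in the power fixed by the whole tuple,
so the associated loop cancels. -/
theorem tupleHom_eq_one {ι : Type*} {x : ι → X}
    (γ : fibreProduct fun i => deckGroup.toGroup (G := G) (x i))
    (hγ : ∀ i, γ.1 i ∈ deckGroup.elliptic G (x i)) : tupleHom x γ = 1 := by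
  choose e he using hγ
  obtain ⟨g, hg⟩ := γ.2
  have h1 := pi_smul hg e
  simp only [he] at h1
  have h2 := eq_orbitLoop_trans (tuplePath_fst hg) h1
  have h : (orbitLoop (tuplePath x γ.1) (mk_tuplePath γ)).symm = .refl _ := by
    rw [← h2]
    rfl
  exact h

theorem piOneProj_tupleHom {ι : Type*} (x : ι → X)
    (γ : fibreProduct fun i => deckGroup.toGroup (G := G) (x i)) (i : ι) :
    OrbitSpace.piOneProj G x (tupleHom x γ) i = deckGroup.toFundamentalGroup G (x i) (γ.1 i) := by
  have h1 := map_proj_orbitLoop i (tuplePath x γ.1) (mk_tuplePath γ) (mk_smul_base (γ.1 i))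
  have h2 : (⟨_, Path.Homotopic.proj i (tuplePath x γ.1).2⟩ : PathClass (x i)) =
      γ.1 i • PathClass.base (x i) :=
    Sigma.ext rfl (heq_of_eq (Path.Homotopic.proj_pi i _))
  replace h1 := h1.trans (orbitLoop_congr h2 (mk_smul_base (γ.1 i)))
  have h3 : ((orbitLoop (tuplePath x γ.1) (mk_tuplePath γ)).symm).map (OrbitSpace.proj G X i) =
      (orbitLoop (γ.1 i • PathClass.base (x i)) (mk_smul_base (γ.1 i))).symm :=
    (Path.Homotopic.Quotient.map_symm _ _).trans (congrArg _ h1)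
  exact h3

end Comparison

theorem corollary1p4 {X G : Type*} [TopologicalSpace X] [T2Space X] [ConnectedSpace X]
    [LocallyPathConnectedSpace X] (hX : SemilocallySimplyConnected X)
    [Group G] [Finite G] [MulAction G X] [ContinuousConstSMul G X]
    (hfix : ∀ g : G, Finite (ZerothHomotopy (MulAction.fixedBy X g)))
    (k : ℕ) (hk : 1 ≤ k) (x : Fin k → X) :
    Finite (OrbitSpace.piOneProj G x).ker ∧ (OrbitSpace.piOneProj G x).range.FiniteIndex := by
  have : PathConnectedSpace X := pathConnectedSpace_iff_connectedSpace.2 inferInstance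
  refine finite_ker_and_finiteIndex_range (fun i => deckGroup.toGroup (x i)) (tupleHom x)
    (fun i => deckGroup.toFundamentalGroup G (x i)) _ (fun i => deckGroup.elliptic G (x i))
    (tupleHom_surjective x) (fun i => deckGroup.toFundamentalGroup_surjective (x i))
    (piOneProj_tupleHom x) (fun i => deckGroup.toGroup_surjective)
    (fun i g s hs => deckGroup.conj_mem_elliptic g hs)
    (fun i s hs => deckGroup.isOfFinOrder_of_mem_elliptic hs) ?_
    (fun i => deckGroup.ker_toFundamentalGroup_le hX (x i)) tupleHom_eq_one
  -- Whether `g` has an elliptic lift depends only on its having a fixed point in `X`, not on the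
  -- base point.
  intro i j s hs
  obtain ⟨z, hz⟩ := deckGroup.exists_fixed_of_mem_elliptic hs
  exact deckGroup.exists_mem_elliptic hz (x j)
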